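/- Let $D$ be a planar diagram of an oriented link $L$ with $p$ positive and $n$ negative crossings. For a Kauffman state $s:\mathrm{Cro}(D)\to\{A,B\}$ let $sD$ be the resulting smoothing, a set of disjoint circles, in which each crossing leaves a scar (a small chord), blue if its label is $A$ and red if it is $B$. A scar is a bichord if its endpoints lie on two different circles. An enhanced state is a state $s$ with a sign $\pm$ on each circle of $sD$; its degrees are $i=$ number of $B$-labels and $j=i+\#\{+\}-\#\{-\}$. Let $\underline{Kh}^{i,j}(D)$ be the homology, over $\mathbb Z$, of the complex $C^{i,j}(D)\to C^{i+1,j}(D)$ freely generated by the enhanced states, with Viro's differential (relative to a numbering of the crossings), and let $Kh^{h,q}(L)=\underline{Kh}^{i,j}(D)$ with $i=h+n$, $j=q-p+2n$. A (blue) ladder of $sD$ of height $h\ge 1$ is a maximal disc of $\mathbb R^2$ that contains exactly two arcs of circles of $sD$ and $h$ parallel blue scars (its steps) joining the two arcs. Cutting all the ladders and joining the two strands at each end of each ladder, one or two circles touch a given ladder; this number is its periphery number. Let $s_0$ be a Kauffman state such that all the blue scars of $s_0D$ are grouped into $k$ ladders $H_1,\dots,H_k$ of heights $h_1,\dots,h_k\ge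 2$. Suppose that: 1. there is a ladder $H_l$ with periphery number one and height $h_l\ge 3$; 2. all the red scars of $s_0D$ become bichords in $s_1D$, where $s_1$ is obtained from $s_0$ by changing into red one step of each ladder. Then the Khovanov homology of $L$ contains an element of order two. Precisely, number the crossings so that the steps of $H_1$ come first, in their order along the ladder, then those of $H_2$, and so on, and finally the remaining crossings. Let $\mu_1,\dots,\mu_k$ be integers with $2\le\mu_l\le h_l$ if $H_l$ has periphery number one and $\mu_l=h_l$ if $H_l$ has periphery number two, such that for some $H_r$ with periphery number one $\mu_r$ is even and $\mu_r<h_r$. (If $H_1,\dots,H_t$ are the ladders with periphery number one, this is a tuple $(\mu_1,\dots,\mu_t,h_{t+1},\dots,h_k)$.) Let $$V(\mu_1,\dots,\mu_k)=\sum_{l\,:\,\mu_l\text{ even},\ \mu_l<h_l}(-1)^{\mu_1+\dots+\mu_{l-1}}\,s(\mu_1,\dots,\mu_{l-1},\mu_l+1,\mu_{l+1},\dots,\mu_k;C_l^{0-}),$$ where $s(\nu_1,\dots,\nu_k;C_l^{0-})$ is the sum of all the enhanced states obtained from $s_0$ by changing into red $\nu_m$ steps of $H_m$ for each $m$, with sign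 $-$ on the circle $C_l^0$ that touches the first red step of $H_l$ from the side of the first end of the ladder, and sign $+$ on all the other circles. Then $V(\mu_1,\dots,\mu_k)$ is a cycle and its class is an element of order two in $\underline{Kh}^{i,j}(D)$, where $i=i_0+1+\sum_l\mu_l$, $j=i_0+|s_1D|+2\sum_l\mu_l-k$, and $i_0$ is the number of red scars of $s_0D$. -/

import Mathlib

/-- The two labels (smoothings) that a Kauffman state can give to a crossing. Scars of
`A`-labelled crossings are blue, scars of `B`-labelled crossings are red. -/
inductive Label : Type
  | A : Label
  | B : Label
  deriving DecidableEq

instance : Fintype Label := ⟨{Label.A, Label.B}, fun x => by cases x <;> decide⟩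

/-- An unoriented link diagram in the plane, up to planar isotopy, as a combinatorial planar map.

Around each crossing `c` there are four half-edges (darts) `(c, 0), (c, 1), (c, 2), (c, 3)`, in
counterclockwise order, where `(c, 0), (c, 2)` lie on the strand passing under and
`(c, 1), (c, 3)` on the strand passing over (the convention of planar diagram codes). `edge` tells
how the darts are joined in pairs by the edges of the diagram. `Loop` is the set of components of
the diagram that have no crossings.

`Region` is the set of connected components of the complement of the diagram in the plane, `outer`
the unbounded one. `left d` is the region to the left of the dart `d`, when `d` is travelled away
from its crossing; it touches the crossing in the corner between `(c, i)` and `(c, i + 1)`.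
`loopSide` gives the regions on the two sides of a crossingless component. -/
structure LinkDiagram where
  Crossing : Type
  [fintypeCrossing : Fintype Crossing]
  [decEqCrossing : DecidableEq Crossing]
  edge : Crossing × Fin 4 → Crossing × Fin 4
  edge_edge : ∀ d, edge (edge d) = d
  edge_ne : ∀ d, edge d ≠ d
  Loop : Type
  [fintypeLoop : Fintype Loop]
  Region : Type
  [fintypeRegion : Fintype Region]
  left : Crossing × Fin 4 → Region
  loopSide : Loop → Bool → Region
  outer : Region
  /-- Walking along an edge with a region on the left and turning left at its end, one keeps
  that region on the left. -/
  left_next : ∀ d, left ((edge d).1, (edge d).2 + 3) = left d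
  /-- Any two regions are connected by a path that crosses the diagram through edges and loops. -/
  connected : ∀ r r' : Region,
    Relation.EqvGen (fun a b => (∃ d, a = left d ∧ b = left (edge d)) ∨
      (∃ o, a = loopSide o false ∧ b = loopSide o true)) r r'
  /-- Euler's formula `V - E + F = 1 + C` for plane graphs: there are `V` crossings, `E = 2 V`
  edges, `F` regions, and `C` connected components of the diagram as a subset of the plane. -/
  euler : (Fintype.card Crossing : ℤ) - 2 * Fintype.card Crossing + Fintype.card Region =
    1 + (Nat.card (Quot fun c c' : Crossing => ∃ i j, edge (c, i) = (c', j)) + Fintype.card Loop)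

namespace LinkDiagram

attribute [instance] LinkDiagram.fintypeCrossing LinkDiagram.decEqCrossing
  LinkDiagram.fintypeLoop LinkDiagram.fintypeRegion

/-- The darts (half-edges) of a diagram. -/
abbrev Dart (D : LinkDiagram) : Type := D.Crossing × Fin 4

/-- Rotating a dart counterclockwise around its crossing by `n` quarter turns. -/
def rot {D : LinkDiagram} (d : D.Dart) (n : Fin 4) : D.Dart := (d.1, d.2 + n)

/-! ### Orientations and signs of crossings -/

/-- An orientation of (the link of) a diagram: `out d` says whether the strand through the dart `d`
leaves the crossing along `d`. Orientations of crossingless components play no role. -/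
structure Orientation (D : LinkDiagram) where
  out : D.Dart → Bool
  out_edge : ∀ d, out (D.edge d) = !(out d)
  out_opposite : ∀ d : D.Dart, out (rot d 2) = !(out d)

/-- A crossing is positive if the directions of the over- and the understrand, in this order, form
a positive basis of the plane. -/
def Orientation.IsPositive {D : LinkDiagram} (o : D.Orientation) (c : D.Crossing) : Prop :=
  o.out (c, 1) = o.out (c, 2)

/-- The number of positive crossings. -/
noncomputable def Orientation.numPos {D : LinkDiagram} (o : D.Orientation) : ℕ :=
  Set.ncard {c | o.IsPositive c}

/-- The number of negative crossings. -/
noncomputable def Orientation.numNeg {D : LinkDiagram} (o : D.Orientation) : ℕ :=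
  Set.ncard {c | ¬ o.IsPositive c}

/-! ### Kauffman states and their circles -/

/-- Kauffman states. -/
abbrev State (D : LinkDiagram) : Type := D.Crossing → Label

/-- The dart to which `d` is joined when its crossing is smoothed. The `A`-smoothing opens the
regions swept by the overstrand when it is rotated counterclockwise, which are the corners
`1, 2` and `3, 0`; so its arcs join `0` with `1` and `2` with `3`. The arcs of the `B`-smoothing
join `1` with `2` and `3` with `0`. -/
def partner {D : LinkDiagram} (s : D.State) (d : D.Dart) : D.Dart :=
  match s d.1 with
  | Label.A => (d.1, ![1, 0, 3, 2] d.2)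
  | Label.B => (d.1, ![3, 2, 1, 0] d.2)

/-- Two darts or loops are directly joined in the smoothing `sD`. -/
inductive Joined {D : LinkDiagram} (s : D.State) : D.Dart ⊕ D.Loop → D.Dart ⊕ D.Loop → Prop
  | edge (d : D.Dart) : Joined s (Sum.inl d) (Sum.inl (D.edge d))
  | arc (d : D.Dart) : Joined s (Sum.inl d) (Sum.inl (partner s d))

/-- The circles of the smoothing `sD`. -/
def Circle {D : LinkDiagram} (s : D.State) : Type := Quot (Joined s)

noncomputable instance {D : LinkDiagram} (s : D.State) : Fintype (Circle s) :=
  haveI : Finite (Circle s) := inferInstanceAs (Finite (Quot (Joined s)))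
  Fintype.ofFinite _

/-- The circle of `sD` that contains a given dart or loop. -/
def circleOf {D : LinkDiagram} (s : D.State) (p : D.Dart ⊕ D.Loop) : Circle s := Quot.mk _ p

/-- The scar of the crossing `c` is a bichord of `sD`: its two endpoints are in different circles.
(For either label, the darts `(c, 0)` and `(c, 2)` lie on the two different arcs at `c`.) -/
def IsBichord {D : LinkDiagram} (s : D.State) (c : D.Crossing) : Prop :=
  circleOf s (Sum.inl (c, 0)) ≠ circleOf s (Sum.inl (c, 2))

/-- The number of `B`-labels of a state. -/
def numB {D : LinkDiagram} (s : D.State) : ℕ :=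
  (Finset.univ.filter fun c => s c = Label.B).card

/-! ### Khovanov homology -/

/-- Enhanced states: a Kauffman state and a sign for each of its circles. -/
structure EnhancedState (D : LinkDiagram) where
  state : D.State
  sign : Circle state → ℤˣ

noncomputable instance (D : LinkDiagram) : Fintype D.EnhancedState :=
  letI (s : D.State) : DecidableEq (Circle s) := Classical.decEq _
  Fintype.ofInjective
    (fun e => (⟨e.state, e.sign⟩ : Σ s : D.State, (Circle s → ℤˣ)))
    (by rintro ⟨s, e⟩ ⟨s', e'⟩ h; cases h; rfl)

namespace EnhancedState

variable {D : LinkDiagram}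

/-- The homological degree `i`. -/
def degI (e : D.EnhancedState) : ℤ := numB e.state

/-- The number of circles with sign `+` minus the number of circles with sign `-`. -/
noncomputable def theta (e : D.EnhancedState) : ℤ := ∑ c, (e.sign c : ℤ)

/-- The quantum degree `j`. -/
noncomputable def degJ (e : D.EnhancedState) : ℤ := e.degI + e.theta

/-- `t` is adjacent to `e` with change crossing `x`. The common circles of both smoothings are
those that do not touch `x`. -/
def AdjacentAt (e t : D.EnhancedState) (x : D.Crossing) : Prop :=
  e.state x = Label.A ∧ t.state = Function.update e.state x Label.B ∧ t.degJ = e.degJ ∧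
    ∀ p : D.Dart ⊕ D.Loop,
      (∀ i, circleOf e.state p ≠ circleOf e.state (Sum.inl (x, i))) →
        t.sign (circleOf t.state p) = e.sign (circleOf e.state p)

end EnhancedState

/-- A numbering of the crossings. -/
abbrev Numbering (D : LinkDiagram) : Type := D.Crossing ≃ Fin (Fintype.card D.Crossing)

open Classical in
/-- The incidence number of `e` over `t`: it is `(-1) ^ k` if `t` is adjacent to `e`, where `k`
counts the `B`-labelled crossings of `e` before the change crossing, and `0` otherwise (at most
one term of the sum does not vanish). -/
noncomputable def incidence (D : LinkDiagram) (ν : D.Numbering) (e t : D.EnhancedState) : ℤ :=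
  ∑ x, if e.AdjacentAt t x then
    (-1) ^ (Finset.univ.filter fun y => e.state y = Label.B ∧ ν y < ν x).card else 0

/-- The chain module `C(D)` with integer coefficients. -/
abbrev Chain (D : LinkDiagram) : Type := D.EnhancedState →₀ ℤ

/-- The differential. -/
noncomputable def diff (D : LinkDiagram) (ν : D.Numbering) : D.Chain →ₗ[ℤ] D.Chain :=
  Finsupp.linearCombination ℤ fun e => ∑ t, Finsupp.single t (D.incidence ν e t)

/-- The bigraded piece `C^{i,j}(D)` of the chain module. -/
noncomputable def chains (D : LinkDiagram) (i j : ℤ) : Submodule ℤ D.Chain :=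
  Finsupp.supported ℤ ℤ {e | e.degI = i ∧ e.degJ = j}

/-- The kernel of the differential on `C^{i,j}(D)`. -/
noncomputable def cycles (D : LinkDiagram) (ν : D.Numbering) (i j : ℤ) : Submodule ℤ D.Chain :=
  D.chains i j ⊓ LinearMap.ker (D.diff ν)

/-- The image of `C^{i-1,j}(D)` under the differential. -/
noncomputable def boundaries (D : LinkDiagram) (ν : D.Numbering) (i j : ℤ) :
    Submodule ℤ D.Chain :=
  (D.chains (i - 1) j).map (D.diff ν)

/-- The Khovanov homology of the diagram, in homological degree `i` and quantum degree `j`. -/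
abbrev Kh (D : LinkDiagram) (ν : D.Numbering) (i j : ℤ) : Type :=
  D.cycles ν i j ⧸ (D.boundaries ν i j).submoduleOf (D.cycles ν i j)

/-- The Khovanov homology of the oriented link of a diagram, in degrees `h` and `q`. -/
abbrev LinkKh (D : LinkDiagram) (o : D.Orientation) (ν : D.Numbering) (h q : ℤ) : Type :=
  D.Kh ν (h + o.numNeg) (q - o.numPos + 2 * o.numNeg)

/-! ### Ladders -/

/-- The left sides of the darts `d` and `f` form a bigon: a bounded region of the complement of the
diagram whose whole boundary consists of two edges, joining the corner of `d` to that of `f`. -/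
def IsBigon (D : LinkDiagram) (d f : D.Dart) : Prop :=
  D.edge d = rot f 1 ∧ D.edge f = rot d 1 ∧ D.left d ≠ D.outer ∧
    (∀ x, D.left x = D.left d → x = d ∨ x = f) ∧ ∀ o b, D.loopSide o b ≠ D.left d

/-- Corners of the crossings are named after their first dart, in counterclockwise order. The
corners on the two sides of a blue scar are the ones opened by the `A`-smoothing. -/
def IsSideOfScar {D : LinkDiagram} (d : D.Dart) : Prop := d.2 = 1 ∨ d.2 = 3

/-- A (blue) ladder of `sD`. Its steps are the scars of distinct `A`-labelled crossings, numbered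
`0, …, height - 1` from one end, the top. `bottom a` is the corner below the `a`-th step and
`rot (bottom a) 2` is the opposite corner, above this step. Any two consecutive steps are parallel:
the corner below a step and the corner above the next one belong to a bigon. The ladder is maximal:
there is no further blue scar parallel to the last or to the first step. -/
structure Ladder (D : LinkDiagram) (s : D.State) where
  height : ℕ
  height_pos : 0 < height
  bottom : Fin height → D.Dart
  isSide : ∀ a, IsSideOfScar (bottom a)
  injective : Function.Injective fun a => (bottom a).1
  blue : ∀ a, s (bottom a).1 = Label.A
  parallel : ∀ a b : Fin height, (b : ℕ) = a + 1 → D.IsBigon (bottom a) (rot (bottom b) 2)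
  maximal_bottom : ∀ d : D.Dart, IsSideOfScar d → s d.1 = Label.A →
    D.IsBigon (bottom ⟨height - 1, Nat.sub_one_lt_of_lt height_pos⟩) d →
      ∃ a, (bottom a).1 = d.1
  maximal_top : ∀ d : D.Dart, IsSideOfScar d → s d.1 = Label.A →
    D.IsBigon (rot (bottom ⟨0, height_pos⟩) 2) d → ∃ a, (bottom a).1 = d.1

namespace Ladder

variable {D : LinkDiagram} {s : D.State}

/-- The crossing of the `a`-th step. -/
def step (H : D.Ladder s) (a : Fin H.height) : D.Crossing := (H.bottom a).1

/-- A dart at the top end of the ladder. -/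
def topEnd (H : D.Ladder s) : D.Dart := rot (H.bottom ⟨0, H.height_pos⟩) 2

/-- A dart at the bottom end of the ladder. -/
def bottomEnd (H : D.Ladder s) : D.Dart :=
  H.bottom ⟨H.height - 1, Nat.sub_one_lt_of_lt H.height_pos⟩

end Ladder

/-- All the blue scars of `sD` are grouped into `k` ladders. -/
structure LadderGrouping (D : LinkDiagram) (s : D.State) (k : ℕ) where
  ladder : Fin k → D.Ladder s
  existsUnique : ∀ c, s c = Label.A →
    ∃! p : Σ l, Fin (ladder l).height, (ladder p.1).step p.2 = c

namespace LadderGrouping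

variable {D : LinkDiagram} {s : D.State} {k : ℕ}

/-- The heights of the ladders. -/
def height (G : D.LadderGrouping s k) (l : Fin k) : ℕ := (G.ladder l).height

open Classical in
/-- The state `s(M_1, …, M_k)`: the steps in `M_l` of the `l`-th ladder are changed to red. -/
noncomputable def redden (G : D.LadderGrouping s k) (M : ∀ l, Finset (Fin (G.height l))) :
    D.State :=
  fun c => if ∃ l, ∃ a ∈ M l, (G.ladder l).step a = c then Label.B else s c

/-- The periphery number of the `l`-th ladder: cut all the ladders, which closes the two strands at
the top end and the two strands at the bottom end of each of them, and count the circles that touch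
the ends of the `l`-th one. (Making all the steps red produces this cut, together with small
circles between consecutive steps that do not touch the ends.) -/
noncomputable def peripheryNumber (G : D.LadderGrouping s k) (l : Fin k) : ℕ :=
  Set.ncard {circleOf (G.redden fun _ => Finset.univ) (Sum.inl (G.ladder l).topEnd),
    circleOf (G.redden fun _ => Finset.univ) (Sum.inl (G.ladder l).bottomEnd)}

/-- The state obtained by breaking all the ladders, the `l`-th one by changing its step `b l` into
red. -/
noncomputable def broken (G : D.LadderGrouping s k) (b : ∀ l, Fin (G.height l)) : D.State :=
  G.redden fun l => {b l}

/-- The crossings are numbered according to the ladders: first the steps of the first ladder, in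
their order, then those of the second ladder and so on, and finally the remaining crossings. -/
def IsAdapted (G : D.LadderGrouping s k) (ν : D.Numbering) : Prop :=
  (∀ l (a a' : Fin (G.ladder l).height), a < a' →
    ν ((G.ladder l).step a) < ν ((G.ladder l).step a')) ∧
  (∀ l l', l < l' → ∀ (a : Fin (G.ladder l).height) (a' : Fin (G.ladder l').height),
    ν ((G.ladder l).step a) < ν ((G.ladder l').step a')) ∧
  ∀ l (a : Fin (G.ladder l).height) (c : D.Crossing),
    (∀ l' a', (G.ladder l').step a' ≠ c) → ν ((G.ladder l).step a) < ν c

open Classical in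
/-- The enhanced state `s(M_1, …, M_k; C_l^{0-})`: all circles have sign `+`, except for the
periphery circle `C_l^0` at the top end of the `l`-th ladder, which has sign `-`. -/
noncomputable def enhance (G : D.LadderGrouping s k) (M : ∀ l, Finset (Fin (G.height l)))
    (l : Fin k) : D.EnhancedState where
  state := G.redden M
  sign c := if c = circleOf (G.redden M) (Sum.inl (G.ladder l).topEnd) then -1 else 1

/-- The chain `s(μ_1, …, μ_k; C_l^{0-})`: the sum over all choices of `μ_m` steps of the `m`-th
ladder, for each `m`. -/
noncomputable def sumChain (G : D.LadderGrouping s k) (μ : Fin k → ℕ) (l : Fin k) : D.Chain :=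
  ∑ M ∈ Fintype.piFinset fun m => Finset.powersetCard (μ m) Finset.univ,
    Finsupp.single (G.enhance M l) 1

/-- The chain `V(μ_1, …, μ_k)`. -/
noncomputable def V (G : D.LadderGrouping s k) (μ : Fin k → ℕ) : D.Chain :=
  ∑ l with Even (μ l) ∧ μ l < G.height l,
    (-1 : ℤ) ^ (∑ m ∈ Finset.Iio l, μ m) • G.sumChain (Function.update μ l (μ l + 1)) l

end LadderGrouping

end LinkDiagram

/-! Once every ladder has a red step, turning one more blue step red always splits a circle. So only
the comultiplication of Viro's differential occurs: a `+` circle becomes `+-` and `-+`, a `-` circle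
becomes `--`. The invariant `depth` tells the small circles between consecutive red steps of a
ladder apart from each other and from the rest. Off these small circles, which points share a circle
does not depend on the chosen red steps (`circleOf_redden_iff`).

Let P be the sum of the all-plus states with `μ l` red steps in each ladder (`plusChain`). Group dP
by target state and by the ladder in which a step was changed. The terms of one ladder form an
alternating sum, over its red steps, of the circles above and below the step; it telescopes to the
top circle minus (-1)^(number of red steps) times the bottom circle (`sum_steps`), the number being
`μ l + 1`. For periphery number one the two circles coincide, so the coefficient is 2 if `μ l` is
even and 0 if it is odd; a ladder with all steps red has no step left to change. Hence dP = 2V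
(`diff_plusChain`). The same telescoping turns dV into a double sum over ladders that is
antisymmetric, so dV = 0 (`diff_V`).

For V not to be a boundary, take a state N that occurs in V for a ladder with `μ r` even and not
maximal. All its red scars are bichords: each ladder has two red steps or more, and the other scars
are covered by the hypothesis on the broken state together with `circleOf_redden_iff`. V lies in the
second highest quantum degree of N, so only all-plus states map into N there, each with two terms of
equal sign. The coefficients of a boundary at N thus have an even sum
(`even_stateSum_of_mem_boundaries`), while for V the sum is 1 or -1 (`stateSum_V`).

These computations use an adapted numbering; a change of signs of the basis carries the result to
any other (`diff_renumber`). -/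

theorem Finset.even_card_of_involution {α : Type*} (K : Finset α) (g : α → α)
    (hmem : ∀ a ∈ K, g a ∈ K) (hinv : ∀ a ∈ K, g (g a) = a) (hne : ∀ a ∈ K, g a ≠ a) :
    Even K.card := by
  have h : ∑ _a ∈ K, (1 : ZMod 2) = 0 :=
    Finset.sum_involution (fun a _ => g a) (fun _ _ => by decide) (fun a ha _ => hne a ha)
      hmem hinv
  rw [Finset.sum_const, nsmul_eq_mul, mul_one] at h
  exact (ZMod.natCast_eq_zero_iff_even).1 h

/-! ### Circles of a smoothing as classes of darts -/

namespace LinkDiagram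

variable {D : LinkDiagram}

theorem circleOf_edge (s : D.State) (d : D.Dart) :
    circleOf s (Sum.inl (D.edge d)) = circleOf s (Sum.inl d) :=
  (Quot.sound (Joined.edge d)).symm

theorem circleOf_partner (s : D.State) (d : D.Dart) :
    circleOf s (Sum.inl (partner s d)) = circleOf s (Sum.inl d) :=
  (Quot.sound (Joined.arc d)).symm

/-- Circles are classes of a generated equivalence relation, so points are shown to lie on different
circles by an invariant of edges and arcs. Every separation argument below goes through this lemma.
-/
theorem eq_of_circleOf_eq {β : Sort*} {s : D.State} (f : D.Dart ⊕ D.Loop → β)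
    (hedge : ∀ d, f (Sum.inl (D.edge d)) = f (Sum.inl d))
    (hpartner : ∀ d, f (Sum.inl (partner s d)) = f (Sum.inl d))
    {p q : D.Dart ⊕ D.Loop} (h : circleOf s p = circleOf s q) : f p = f q := by
  have key : ∀ a b, Joined s a b → f a = f b := by
    rintro _ _ (d | d)
    · exact (hedge d).symm
    · exact (hpartner d).symm
  exact congrArg (Quot.lift f key) h

theorem partner_of_A {s : D.State} {d : D.Dart} (h : s d.1 = Label.A) :
    partner s d = (d.1, ![1, 0, 3, 2] d.2) := by
  simp [partner, h]

theorem partner_of_B {s : D.State} {d : D.Dart} (h : s d.1 = Label.B) :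
    partner s d = (d.1, ![3, 2, 1, 0] d.2) := by
  simp [partner, h]

theorem partner_congr {s t : D.State} {d : D.Dart} (h : s d.1 = t d.1) :
    partner s d = partner t d := by
  simp [partner, h]

theorem partner_fst (s : D.State) (d : D.Dart) : (partner s d).1 = d.1 := by
  unfold partner; split <;> rfl

theorem partner_partner (s : D.State) (d : D.Dart) : partner s (partner s d) = d := by
  obtain ⟨c, i⟩ := d
  cases h : s c <;> fin_cases i <;> simp [partner, h]

theorem partner_ne (s : D.State) (d : D.Dart) : partner s d ≠ d := by
  obtain ⟨c, i⟩ := d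
  cases h : s c <;> fin_cases i <;> simp [partner, h]

theorem circleOf_A_zero {s : D.State} {x : D.Crossing} (h : s x = Label.A) :
    circleOf s (Sum.inl (x, 1)) = circleOf s (Sum.inl (x, 0)) := by
  have := circleOf_partner s (x, 0)
  rwa [partner_of_A h] at this

theorem circleOf_A_two {s : D.State} {x : D.Crossing} (h : s x = Label.A) :
    circleOf s (Sum.inl (x, 3)) = circleOf s (Sum.inl (x, 2)) := by
  have := circleOf_partner s (x, 2)
  rwa [partner_of_A h] at this

theorem circleOf_B_zero {s : D.State} {x : D.Crossing} (h : s x = Label.B) :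
    circleOf s (Sum.inl (x, 3)) = circleOf s (Sum.inl (x, 0)) := by
  have := circleOf_partner s (x, 0)
  rwa [partner_of_B h] at this

theorem circleOf_B_two {s : D.State} {x : D.Crossing} (h : s x = Label.B) :
    circleOf s (Sum.inl (x, 1)) = circleOf s (Sum.inl (x, 2)) := by
  have := circleOf_partner s (x, 2)
  rwa [partner_of_B h] at this

/-! ### Changing a blue scar into a red bichord -/

section Split

variable {s : D.State} {x : D.Crossing}

/-- The four darts at a blue scar lie on one circle if changing the scar makes it a bichord. -/
theorem circleOf_zero_eq_three (hs : s x = Label.A)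
    (hx : IsBichord (Function.update s x Label.B) x) :
    circleOf s (Sum.inl (x, 0)) = circleOf s (Sum.inl (x, 3)) := by
  classical
  set t := Function.update s x Label.B with ht
  have htx : t x = Label.B := by simp [ht]
  by_contra hne
  -- The darts common to both circles through `(x, 0)`. Edges pair them off. If the claim fails,
  -- `(x, 0)` is the only one of them at `x`, and the arcs pair off all the others: the number is
  -- both even and odd.
  let K : Finset D.Dart := Finset.univ.filter fun d =>
    circleOf s (Sum.inl d) = circleOf s (Sum.inl (x, 0)) ∧
      circleOf t (Sum.inl d) = circleOf t (Sum.inl (x, 0))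
  have h0 : (x, 0) ∈ K := by simp [K]
  have hK : Even K.card := by
    refine Finset.even_card_of_involution K D.edge ?_ (fun d _ => D.edge_edge d)
      (fun d _ => D.edge_ne d)
    intro d hd
    simpa [K, circleOf_edge] using hd
  have hcross : ∀ d ∈ K.erase (x, 0), d.1 ≠ x := by
    rintro ⟨c, i⟩ hd rfl
    simp only [K, Finset.mem_erase, Finset.mem_filter, Finset.mem_univ, true_and] at hd
    obtain ⟨hi, h1, h2⟩ := hd
    fin_cases i
    · exact hi rfl
    · exact hx (h2.symm.trans (circleOf_B_two htx))
    · exact hx h2.symm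
    · exact hne h1.symm
  have hE : Even (K.erase (x, 0)).card := by
    refine Finset.even_card_of_involution _ (partner t) ?_ (fun d _ => partner_partner t d)
      (fun d _ => partner_ne t d)
    intro d hd
    have hdx := hcross d hd
    have hp : partner t d = partner s d := partner_congr (by simp [ht, hdx])
    refine Finset.mem_erase.2 ⟨?_, ?_⟩
    · intro h
      exact hdx (by rw [← partner_fst t d, h])
    · have hd' := Finset.mem_of_mem_erase hd
      simp only [K, Finset.mem_filter, Finset.mem_univ, true_and] at hd' ⊢
      exact ⟨by rw [hp, circleOf_partner]; exact hd'.1, by rw [circleOf_partner]; exact hd'.2⟩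
  rw [Finset.card_erase_of_mem h0] at hE
  have := Finset.card_pos.2 ⟨_, h0⟩
  obtain ⟨a, ha⟩ := hK
  obtain ⟨b, hb⟩ := hE
  omega

theorem circleOf_crossing (hs : s x = Label.A)
    (hx : IsBichord (Function.update s x Label.B) x) (i : Fin 4) :
    circleOf s (Sum.inl (x, i)) = circleOf s (Sum.inl (x, 0)) := by
  have h := circleOf_zero_eq_three hs hx
  have h1 := circleOf_A_zero hs
  have h2 := circleOf_A_two hs
  fin_cases i
  · rfl
  · exact h1
  · exact h2.symm.trans h.symm
  · exact h.symm

theorem circleOf_update_crossing (i : Fin 4) :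
    circleOf (Function.update s x Label.B) (Sum.inl (x, i)) =
        circleOf (Function.update s x Label.B) (Sum.inl (x, 0)) ∨
      circleOf (Function.update s x Label.B) (Sum.inl (x, i)) =
        circleOf (Function.update s x Label.B) (Sum.inl (x, 2)) := by
  have htx : Function.update s x Label.B x = Label.B := by simp
  fin_cases i
  · exact Or.inl rfl
  · exact Or.inr (circleOf_B_two htx)
  · exact Or.inr rfl
  · exact Or.inl (circleOf_B_zero htx)

/-- The smoothings differ only at `x`, where all four darts are on one circle of `s`; so the new
circles refine the old ones. -/
theorem circleOf_eq_of_update (hs : s x = Label.A)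
    (hx : IsBichord (Function.update s x Label.B) x) {p q : D.Dart ⊕ D.Loop}
    (h : circleOf (Function.update s x Label.B) p = circleOf (Function.update s x Label.B) q) :
    circleOf s p = circleOf s q := by
  refine eq_of_circleOf_eq (circleOf s) (circleOf_edge s) ?_ h
  rintro ⟨c, i⟩
  by_cases hc : c = x
  · subst hc
    have := partner_fst (Function.update s c Label.B) (c, i)
    rw [← Prod.mk.eta (p := partner _ _), this, circleOf_crossing hs hx, circleOf_crossing hs hx i]
  · rw [partner_congr (t := s) (by simp [hc]), circleOf_partner]

theorem circleOf_update_of_eq {p q : D.Dart ⊕ D.Loop} (h : circleOf s p = circleOf s q) :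
    circleOf (Function.update s x Label.B) p = circleOf (Function.update s x Label.B) q ∨
      (circleOf (Function.update s x Label.B) p =
            circleOf (Function.update s x Label.B) (Sum.inl (x, 0)) ∨
          circleOf (Function.update s x Label.B) p =
            circleOf (Function.update s x Label.B) (Sum.inl (x, 2))) ∧
        (circleOf (Function.update s x Label.B) q =
            circleOf (Function.update s x Label.B) (Sum.inl (x, 0)) ∨
          circleOf (Function.update s x Label.B) q =
            circleOf (Function.update s x Label.B) (Sum.inl (x, 2))) := by
  classical
  set t := Function.update s x Label.B with ht
  -- Gluing the two new circles at `x` gives a function that is constant on the circles of `s`.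
  let f : D.Dart ⊕ D.Loop → Circle t := fun p =>
    if circleOf t p = circleOf t (Sum.inl (x, 2)) then circleOf t (Sum.inl (x, 0))
    else circleOf t p
  have hf : f p = f q := by
    refine eq_of_circleOf_eq f (fun d => by simp only [f, circleOf_edge]) ?_ h
    rintro ⟨c, i⟩
    by_cases hc : c = x
    · subst hc
      have key : ∀ j, f (Sum.inl (c, j)) = circleOf t (Sum.inl (c, 0)) := by
        intro j
        by_cases h2 : circleOf t (Sum.inl (c, j)) = circleOf t (Sum.inl (c, 2))
        · simp [f, h2]
        · simpa [f, h2] using (circleOf_update_crossing (s := s) (x := c) j).resolve_right h2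
      have := partner_fst s (c, i)
      rw [← Prod.mk.eta (p := partner _ _), this, key, key]
    · rw [partner_congr (t := t) (by simp [ht, hc])]
      simp only [f, circleOf_partner]
  simp only [f] at hf
  split_ifs at hf <;> tauto

theorem circleOf_eq_crossing_iff (hs : s x = Label.A)
    (hx : IsBichord (Function.update s x Label.B) x) (p : D.Dart ⊕ D.Loop) (i : Fin 4) :
    circleOf s p = circleOf s (Sum.inl (x, i)) ↔
      circleOf (Function.update s x Label.B) p =
          circleOf (Function.update s x Label.B) (Sum.inl (x, 0)) ∨
        circleOf (Function.update s x Label.B) p =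
          circleOf (Function.update s x Label.B) (Sum.inl (x, 2)) := by
  constructor
  · intro h
    rcases circleOf_update_of_eq (x := x) h with h | h
    · rw [h]; exact circleOf_update_crossing i
    · exact h.1
  · rintro (h | h)
    · rw [circleOf_eq_of_update hs hx h, circleOf_crossing hs hx i]
    · rw [circleOf_eq_of_update hs hx h, circleOf_crossing hs hx i, circleOf_crossing hs hx 2]

/-- The map from new circles to old ones becomes a bijection once one of the two circles at `x` is
left out. -/
theorem card_circle_update (hs : s x = Label.A)
    (hx : IsBichord (Function.update s x Label.B) x) :
    Fintype.card (Circle (Function.update s x Label.B)) = Fintype.card (Circle s) + 1 := by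
  classical
  set t := Function.update s x Label.B with ht
  let Q := circleOf t (Sum.inl (x, 2))
  let π : Circle t → Circle s := Quot.lift (circleOf s) fun a b hab =>
    circleOf_eq_of_update hs hx (Quot.sound hab)
  have hπ : ∀ p, π (circleOf t p) = circleOf s p := fun _ => rfl
  have hb : Function.Bijective fun c : {c : Circle t // c ≠ Q} => π c := by
    constructor
    · rintro ⟨c, hc⟩ ⟨c', hc'⟩ h
      obtain ⟨p, rfl⟩ : ∃ p, circleOf t p = c := Quot.exists_rep c
      obtain ⟨q, rfl⟩ : ∃ p, circleOf t p = c' := Quot.exists_rep c'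
      simp only [hπ] at h
      refine Subtype.ext ?_
      rcases circleOf_update_of_eq (x := x) h with h | ⟨h1, h2⟩
      · exact h
      · exact (h1.resolve_right hc).trans (h2.resolve_right hc').symm
    · intro c
      obtain ⟨p, rfl⟩ : ∃ p, circleOf s p = c := Quot.exists_rep c
      by_cases hp : circleOf t p = Q
      · refine ⟨⟨circleOf t (Sum.inl (x, 0)), hx⟩, ?_⟩
        simp only [hπ]
        exact (circleOf_crossing hs hx 2).symm.trans (circleOf_eq_of_update hs hx hp).symm
      · exact ⟨⟨circleOf t p, hp⟩, rfl⟩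
  rw [← Fintype.card_of_bijective hb, Fintype.card_subtype_compl, Fintype.card_subtype_eq]
  have := Fintype.card_pos_iff.2 ⟨Q⟩
  omega

end Split

end LinkDiagram

/-! ### Signs of circles and the differential at a splitting -/

namespace LinkDiagram

variable {D : LinkDiagram}

open Classical in
/-- The circles with sign `-`. -/
noncomputable def negs {s : D.State} (f : Circle s → ℤˣ) : Finset (Circle s) :=
  Finset.univ.filter fun c => f c = -1

theorem mem_negs {s : D.State} {f : Circle s → ℤˣ} {c : Circle s} : c ∈ negs f ↔ f c = -1 := by
  simp [negs]

theorem eq_one_iff_ne_neg_one {u : ℤˣ} : u = 1 ↔ u ≠ -1 := by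
  rcases Int.units_eq_one_or u with rfl | rfl <;> decide

theorem eq_of_negs_eq {s : D.State} {f g : Circle s → ℤˣ} (h : negs f = negs g) : f = g := by
  funext c
  have hc : f c = -1 ↔ g c = -1 := by rw [← mem_negs, ← mem_negs, h]
  rcases Int.units_eq_one_or (f c) with h1 | h1
  · rw [h1, eq_comm, eq_one_iff_ne_neg_one, Ne, ← hc, h1]; decide
  · rw [h1, hc.1 h1]

theorem theta_eq {s : D.State} (f : Circle s → ℤˣ) :
    (EnhancedState.mk s f).theta = Fintype.card (Circle s) - 2 * (negs f).card := by
  classical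
  have h : ∀ c, (f c : ℤ) = 1 - 2 * (if f c = -1 then 1 else 0) := by
    intro c
    rcases Int.units_eq_one_or (f c) with h | h <;> rw [h] <;> decide
  unfold EnhancedState.theta
  simp only [h, Finset.sum_sub_distrib, ← Finset.mul_sum, negs, Finset.sum_boole]
  simp

theorem degJ_eq {s : D.State} (f : Circle s → ℤˣ) :
    (EnhancedState.mk s f).degJ =
      numB s + (Fintype.card (Circle s) - 2 * (negs f).card) := by
  unfold EnhancedState.degJ EnhancedState.degI
  rw [theta_eq]

theorem numB_update {s : D.State} {x : D.Crossing} (hs : s x = Label.A) :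
    numB (Function.update s x Label.B) = numB s + 1 := by
  unfold numB
  have : (Finset.univ.filter fun c => Function.update s x Label.B c = Label.B) =
      insert x (Finset.univ.filter fun c => s c = Label.B) := by
    ext c
    by_cases hc : c = x
    · simp [hc]
    · simp [hc]
  rw [this, Finset.card_insert_of_notMem (by simp [hs])]

theorem adjacentAt_state {e u : D.EnhancedState} {x : D.Crossing} (h : e.AdjacentAt u x) :
    u.state = Function.update e.state x Label.B := h.2.1

/-- Adjacency, when the change of the crossing splits a circle. -/
theorem adjacentAt_iff {s : D.State} {x : D.Crossing} (hs : s x = Label.A)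
    (hx : IsBichord (Function.update s x Label.B) x) (g : Circle s → ℤˣ)
    (f : Circle (Function.update s x Label.B) → ℤˣ) :
    (EnhancedState.mk s g).AdjacentAt ⟨Function.update s x Label.B, f⟩ x ↔
      (negs f).card = (negs g).card + 1 ∧
        ∀ p, circleOf (Function.update s x Label.B) p ≠
            circleOf (Function.update s x Label.B) (Sum.inl (x, 0)) →
          circleOf (Function.update s x Label.B) p ≠
            circleOf (Function.update s x Label.B) (Sum.inl (x, 2)) →
          f (circleOf (Function.update s x Label.B) p) = g (circleOf s p) := by
  unfold EnhancedState.AdjacentAt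
  -- The number of red labels and the number of circles each grow by one, so equality of quantum
  -- degrees means exactly one more `-`.
  rw [degJ_eq, degJ_eq, numB_update hs, card_circle_update hs hx]
  have h1 : (∀ p : D.Dart ⊕ D.Loop, (∀ i, circleOf s p ≠ circleOf s (Sum.inl (x, i))) →
      f (circleOf (Function.update s x Label.B) p) = g (circleOf s p)) ↔
      ∀ p, circleOf (Function.update s x Label.B) p ≠
            circleOf (Function.update s x Label.B) (Sum.inl (x, 0)) →
          circleOf (Function.update s x Label.B) p ≠
            circleOf (Function.update s x Label.B) (Sum.inl (x, 2)) →
          f (circleOf (Function.update s x Label.B) p) = g (circleOf s p) := by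
    refine forall_congr' fun p => ?_
    simp only [Ne, circleOf_eq_crossing_iff hs hx, not_or, forall_const, and_imp]
  simp only [hs, true_and]
  rw [h1]
  push_cast
  constructor
  · rintro ⟨h, h'⟩
    exact ⟨by omega, h'⟩
  · rintro ⟨h, h'⟩
    exact ⟨by omega, h'⟩

/-- The enhanced state with all signs `+`. -/
def plus (s : D.State) : D.EnhancedState := ⟨s, fun _ => 1⟩

open Classical in
/-- The signs that are `-` exactly at the circle of `p`. -/
noncomputable def markSign (s : D.State) (p : D.Dart ⊕ D.Loop) : Circle s → ℤˣ :=
  fun c => if c = circleOf s p then -1 else 1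

open Classical in
/-- The signs that are `-` exactly at the circles of `p` and `q`. -/
noncomputable def markTwoSign (s : D.State) (p q : D.Dart ⊕ D.Loop) : Circle s → ℤˣ :=
  fun c => if c = circleOf s p ∨ c = circleOf s q then -1 else 1

/-- The enhanced state with sign `-` exactly at the circle of `p`. -/
noncomputable def mark (s : D.State) (p : D.Dart ⊕ D.Loop) : D.EnhancedState :=
  ⟨s, markSign s p⟩

/-- The enhanced state with sign `-` exactly at the circles of `p` and `q`. -/
noncomputable def markTwo (s : D.State) (p q : D.Dart ⊕ D.Loop) : D.EnhancedState :=
  ⟨s, markTwoSign s p q⟩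

open Classical in
/-- The chain of the enhanced state with sign `-` exactly at the circles of `p` and `q`, or zero if
these circles coincide. -/
noncomputable def chainTwo (s : D.State) (p q : D.Dart ⊕ D.Loop) : D.Chain :=
  if circleOf s p = circleOf s q then 0 else Finsupp.single (markTwo s p q) 1

theorem negs_one (s : D.State) : negs (fun _ : Circle s => (1 : ℤˣ)) = ∅ := by
  ext c
  simp only [mem_negs, Finset.notMem_empty, iff_false]
  decide

theorem negs_markSign (s : D.State) (p : D.Dart ⊕ D.Loop) :
    negs (markSign s p) = {circleOf s p} := by
  ext c
  simp only [mem_negs, markSign, Finset.mem_singleton]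
  split_ifs with h
  · simp [h]
  · simp only [h, iff_false]; decide

theorem negs_markTwoSign {s : D.State} [DecidableEq (Circle s)] (p q : D.Dart ⊕ D.Loop) :
    negs (markTwoSign s p q) = {circleOf s p, circleOf s q} := by
  ext c
  simp only [mem_negs, markTwoSign, Finset.mem_singleton, Finset.mem_insert]
  split_ifs with h
  · simp [h]
  · simp only [h, iff_false]; decide

theorem mark_congr {s : D.State} {p q : D.Dart ⊕ D.Loop} (h : circleOf s p = circleOf s q) :
    mark s p = mark s q := by
  unfold mark markSign
  rw [h]

theorem markTwo_congr {s : D.State} {r p q : D.Dart ⊕ D.Loop}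
    (h : circleOf s p = circleOf s q) : markTwo s r p = markTwo s r q := by
  unfold markTwo markTwoSign
  rw [h]

theorem markTwo_comm (s : D.State) (p q : D.Dart ⊕ D.Loop) : markTwo s p q = markTwo s q p := by
  classical
  have : markTwoSign s p q = markTwoSign s q p :=
    eq_of_negs_eq (by rw [negs_markTwoSign, negs_markTwoSign, Finset.pair_comm])
  rw [markTwo, this, markTwo]

theorem chainTwo_congr {s : D.State} {r p q : D.Dart ⊕ D.Loop}
    (h : circleOf s p = circleOf s q) : chainTwo s r p = chainTwo s r q := by
  unfold chainTwo
  rw [h, markTwo_congr h]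

theorem chainTwo_comm (s : D.State) (p q : D.Dart ⊕ D.Loop) :
    chainTwo s p q = chainTwo s q p := by
  unfold chainTwo
  rw [markTwo_comm]
  by_cases h : circleOf s p = circleOf s q
  · rw [if_pos h, if_pos h.symm]
  · rw [if_neg h, if_neg fun h' => h h'.symm]

theorem chainTwo_self (s : D.State) (p : D.Dart ⊕ D.Loop) : chainTwo s p p = 0 :=
  if_pos rfl

theorem mark_injective {s : D.State} {p q : D.Dart ⊕ D.Loop} (h : mark s p = mark s q) :
    circleOf s p = circleOf s q := by
  have h' : markSign s p = markSign s q := by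
    simpa only [mark, EnhancedState.mk.injEq, heq_eq_eq, true_and] using h
  have h2 := congrArg negs h'
  rw [negs_markSign, negs_markSign] at h2
  exact Finset.singleton_injective h2

section Split

variable {s : D.State} {x : D.Crossing}

/-- The splitting rule for a `+` circle: exactly one half receives `-`. -/
theorem plus_adjacentAt_iff (hs : s x = Label.A)
    (hx : IsBichord (Function.update s x Label.B) x) (u : D.EnhancedState) :
    (plus s).AdjacentAt u x ↔ u = mark (Function.update s x Label.B) (Sum.inl (x, 0)) ∨
      u = mark (Function.update s x Label.B) (Sum.inl (x, 2)) := by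
  classical
  set t := Function.update s x Label.B with ht
  have hmark : ∀ p, circleOf t p = circleOf t (Sum.inl (x, 0)) ∨
      circleOf t p = circleOf t (Sum.inl (x, 2)) → (plus s).AdjacentAt (mark t p) x := by
    intro p hp
    refine (adjacentAt_iff hs hx _ _).2 ⟨?_, ?_⟩
    · rw [negs_one, negs_markSign, Finset.card_singleton, Finset.card_empty]
    · intro q h1 h2
      refine if_neg fun h => ?_
      rw [h] at h1 h2
      tauto
  constructor
  · intro h
    obtain ⟨u, f⟩ := u
    obtain rfl : u = t := adjacentAt_state h
    obtain ⟨hc, hf⟩ := (adjacentAt_iff hs hx _ _).1 h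
    rw [negs_one, Finset.card_empty, zero_add, Finset.card_eq_one] at hc
    obtain ⟨c, hc⟩ := hc
    obtain ⟨p, rfl⟩ : ∃ p, circleOf t p = c := Quot.exists_rep c
    have hfm : EnhancedState.mk t f = mark t p := by
      have : f = markSign t p := eq_of_negs_eq (hc.trans (negs_markSign t p).symm)
      rw [this]; rfl
    have hfp : f (circleOf t p) = -1 := mem_negs.1 (hc ▸ Finset.mem_singleton_self _)
    rw [hfm]
    by_cases h0 : circleOf t p = circleOf t (Sum.inl (x, 0))
    · exact Or.inl (mark_congr h0)
    by_cases h2 : circleOf t p = circleOf t (Sum.inl (x, 2))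
    · exact Or.inr (mark_congr h2)
    have := hf p h0 h2
    rw [hfp] at this
    exact absurd this (by decide)
  · rintro (rfl | rfl)
    · exact hmark _ (Or.inl rfl)
    · exact hmark _ (Or.inr rfl)

/-- The splitting rule for a `-` circle: there must be two `-` signs and all circles away from `x`
are `+`, so both halves carry `-`. -/
theorem mark_adjacentAt_of_mem (hs : s x = Label.A)
    (hx : IsBichord (Function.update s x Label.B) x) {r : D.Dart ⊕ D.Loop}
    (hr : circleOf s r = circleOf s (Sum.inl (x, 0))) (u : D.EnhancedState) :
    (mark s r).AdjacentAt u x ↔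
      u = markTwo (Function.update s x Label.B) (Sum.inl (x, 0)) (Sum.inl (x, 2)) := by
  classical
  set t := Function.update s x Label.B with ht
  have hn := negs_markTwoSign (s := t) (Sum.inl (x, 0)) (Sum.inl (x, 2))
  constructor
  · intro h
    obtain ⟨u, f⟩ := u
    obtain rfl : u = t := adjacentAt_state h
    obtain ⟨hc, hf⟩ := (adjacentAt_iff hs hx _ _).1 h
    have hc2 : (negs f).card = 2 := hc.trans (by rw [negs_markSign]; rfl)
    have hsub : negs f ⊆ {circleOf t (Sum.inl (x, 0)), circleOf t (Sum.inl (x, 2))} := by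
      intro c hcm
      obtain ⟨p, rfl⟩ : ∃ p, circleOf t p = c := Quot.exists_rep c
      by_contra hcon
      simp only [Finset.mem_insert, Finset.mem_singleton, not_or] at hcon
      have h1 := hf p hcon.1 hcon.2
      rw [mem_negs.1 hcm, eq_comm, ← mem_negs (f := markSign s r)] at h1
      rw [negs_markSign] at h1
      rw [Finset.mem_singleton, hr, circleOf_eq_crossing_iff hs hx] at h1
      exact h1.elim hcon.1 hcon.2
    have heq := Finset.eq_of_subset_of_card_le hsub (by rw [hc2, Finset.card_pair hx])
    have : f = markTwoSign t (Sum.inl (x, 0)) (Sum.inl (x, 2)) :=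
      eq_of_negs_eq (heq.trans hn.symm)
    rw [this]; rfl
  · rintro rfl
    refine (adjacentAt_iff hs hx _ _).2 ⟨?_, ?_⟩
    · rw [hn, negs_markSign]
      rw [Finset.card_pair hx, Finset.card_singleton]
    · intro p h1 h2
      refine (if_neg (by tauto)).trans (if_neg ?_).symm
      rw [hr, circleOf_eq_crossing_iff hs hx]
      tauto

theorem mark_adjacentAt_of_notMem (hs : s x = Label.A)
    (hx : IsBichord (Function.update s x Label.B) x) {r : D.Dart ⊕ D.Loop}
    (hr : circleOf s r ≠ circleOf s (Sum.inl (x, 0))) (u : D.EnhancedState) :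
    (mark s r).AdjacentAt u x ↔
      u = markTwo (Function.update s x Label.B) r (Sum.inl (x, 0)) ∨
      u = markTwo (Function.update s x Label.B) r (Sum.inl (x, 2)) := by
  classical
  set t := Function.update s x Label.B with ht
  have hr' := hr
  rw [Ne, circleOf_eq_crossing_iff hs hx, not_or] at hr'
  obtain ⟨hr0, hr2⟩ := hr'
  have hsr : ∀ p, circleOf t p ≠ circleOf t (Sum.inl (x, 0)) →
      circleOf t p ≠ circleOf t (Sum.inl (x, 2)) →
      (circleOf s p = circleOf s r ↔ circleOf t p = circleOf t r) := by
    intro p h0 h2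
    refine ⟨fun h => ?_, circleOf_eq_of_update hs hx⟩
    rcases circleOf_update_of_eq (x := x) h with h | ⟨h, -⟩
    · exact h
    · exact absurd h (by tauto)
  have hmark : ∀ p, circleOf t p = circleOf t (Sum.inl (x, 0)) ∨
      circleOf t p = circleOf t (Sum.inl (x, 2)) → (mark s r).AdjacentAt (markTwo t r p) x := by
    intro p hp
    have hrp : circleOf t r ≠ circleOf t p := by rcases hp with h | h <;> rwa [h]
    refine (adjacentAt_iff hs hx _ _).2 ⟨?_, ?_⟩
    · rw [negs_markTwoSign, negs_markSign]
      rw [Finset.card_pair hrp, Finset.card_singleton]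
    · intro q h1 h2
      have hqp : circleOf t q ≠ circleOf t p := by rcases hp with h | h <;> rwa [h]
      change markTwoSign t r p (circleOf t q) = markSign s r (circleOf s q)
      simp only [markTwoSign, markSign, hqp, or_false, hsr q h1 h2]
  constructor
  · intro h
    obtain ⟨u, f⟩ := u
    obtain rfl : u = t := adjacentAt_state h
    obtain ⟨hc, hf⟩ := (adjacentAt_iff hs hx _ _).1 h
    have hc2 : (negs f).card = 2 := hc.trans (by rw [negs_markSign]; rfl)
    have hrm : circleOf t r ∈ negs f := by
      rw [mem_negs, hf r hr0 hr2]
      exact if_pos rfl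
    have hne : ∃ c ∈ negs f, c ≠ circleOf t r :=
      Finset.exists_mem_ne (by rw [hc2]; decide) _
    obtain ⟨c, hcm, hcr⟩ := hne
    obtain ⟨p, rfl⟩ : ∃ p, circleOf t p = c := Quot.exists_rep c
    have heq : {circleOf t r, circleOf t p} = negs f := by
      refine Finset.eq_of_subset_of_card_le ?_ (by rw [hc2, Finset.card_pair hcr.symm])
      intro c hc
      simp only [Finset.mem_insert, Finset.mem_singleton] at hc
      rcases hc with rfl | rfl <;> assumption
    have hp : circleOf t p = circleOf t (Sum.inl (x, 0)) ∨
        circleOf t p = circleOf t (Sum.inl (x, 2)) := by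
      by_contra hcon
      rw [not_or] at hcon
      have h1 := hf p hcon.1 hcon.2
      rw [mem_negs.1 hcm, eq_comm, ← mem_negs (f := markSign s r)] at h1
      rw [negs_markSign] at h1
      rw [Finset.mem_singleton, hsr p hcon.1 hcon.2] at h1
      exact hcr h1
    have hfp : EnhancedState.mk t f = markTwo t r p := by
      have : f = markTwoSign t r p := eq_of_negs_eq (heq.symm.trans (negs_markTwoSign r p).symm)
      rw [this]; rfl
    rw [hfp]
    exact hp.imp markTwo_congr markTwo_congr
  · rintro (rfl | rfl)
    · exact hmark _ (Or.inl rfl)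
    · exact hmark _ (Or.inr rfl)

open Classical in
theorem sum_adjacentAt_plus (hs : s x = Label.A)
    (hx : IsBichord (Function.update s x Label.B) x) :
    (∑ u, if (plus s).AdjacentAt u x then Finsupp.single u (1 : ℤ) else 0) =
      Finsupp.single (mark (Function.update s x Label.B) (Sum.inl (x, 0))) 1 +
        Finsupp.single (mark (Function.update s x Label.B) (Sum.inl (x, 2))) 1 := by
  rw [← Finset.sum_filter]
  have : (Finset.univ.filter fun u => (plus s).AdjacentAt u x) =
      {mark (Function.update s x Label.B) (Sum.inl (x, 0)),
        mark (Function.update s x Label.B) (Sum.inl (x, 2))} := by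
    ext u
    simp [plus_adjacentAt_iff hs hx]
  rw [this, Finset.sum_pair fun h => hx (mark_injective h)]

open Classical in
-- The zero convention in `chainTwo` unites two cases. If the circle of `r` is the one that splits,
-- `r` lies on one of the halves, the term of this half vanishes and the other is the state with
-- both halves negative.
theorem sum_adjacentAt_mark (hs : s x = Label.A)
    (hx : IsBichord (Function.update s x Label.B) x) (r : D.Dart ⊕ D.Loop) :
    (∑ u, if (mark s r).AdjacentAt u x then Finsupp.single u (1 : ℤ) else 0) =
      chainTwo (Function.update s x Label.B) r (Sum.inl (x, 0)) +
        chainTwo (Function.update s x Label.B) r (Sum.inl (x, 2)) := by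
  set t := Function.update s x Label.B with ht
  by_cases hr : circleOf s r = circleOf s (Sum.inl (x, 0))
  · simp only [mark_adjacentAt_of_mem hs hx hr, Finset.sum_ite_eq', Finset.mem_univ, if_true]
    rcases (circleOf_eq_crossing_iff hs hx r 0).1 hr with h | h
    · rw [chainTwo_comm t r, chainTwo_congr h, chainTwo_self, zero_add, chainTwo_comm,
        chainTwo_congr h, chainTwo_comm, chainTwo, if_neg hx]
    · rw [chainTwo_comm t r (Sum.inl (x, 2)), chainTwo_congr h, chainTwo_self, add_zero,
        chainTwo_comm, chainTwo_congr h, chainTwo, if_neg hx]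
  · have hr' := hr
    rw [circleOf_eq_crossing_iff hs hx, not_or] at hr'
    rw [← Finset.sum_filter]
    have : (Finset.univ.filter fun u => (mark s r).AdjacentAt u x) =
        {markTwo t r (Sum.inl (x, 0)), markTwo t r (Sum.inl (x, 2))} := by
      ext u
      simp [mark_adjacentAt_of_notMem hs hx hr, ht]
    rw [this, Finset.sum_pair]
    · rw [chainTwo, if_neg hr'.1, chainTwo, if_neg hr'.2]
    · intro h
      have h' : markTwoSign t r (Sum.inl (x, 0)) = markTwoSign t r (Sum.inl (x, 2)) := by
        simpa only [markTwo, EnhancedState.mk.injEq, heq_eq_eq, true_and] using h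
      have h2 := congrArg negs h'
      rw [negs_markTwoSign, negs_markTwoSign] at h2
      have : circleOf t (Sum.inl (x, 0)) ∈
          ({circleOf t r, circleOf t (Sum.inl (x, 0))} : Finset (Circle t)) := by simp
      rw [h2] at this
      simp only [Finset.mem_insert, Finset.mem_singleton] at this
      exact this.elim (fun h => hr'.1 h.symm) hx

end Split

/-! ### The differential -/

/-- The number of red scars before the crossing `x`. -/
def redBefore (s : D.State) (ν : D.Numbering) (x : D.Crossing) : ℕ :=
  (Finset.univ.filter fun y => s y = Label.B ∧ ν y < ν x).card

theorem diff_single (ν : D.Numbering) (e : D.EnhancedState) :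
    D.diff ν (Finsupp.single e 1) = ∑ u, Finsupp.single u (D.incidence ν e u) := by
  simp [diff]

open Classical in
theorem diff_single_eq_sum (ν : D.Numbering) (e : D.EnhancedState) :
    D.diff ν (Finsupp.single e 1) = ∑ x, (-1 : ℤ) ^ redBefore e.state ν x •
      ∑ u, if e.AdjacentAt u x then Finsupp.single u (1 : ℤ) else 0 := by
  rw [diff_single]
  simp only [Finset.smul_sum]
  rw [Finset.sum_comm]
  refine Finset.sum_congr rfl fun u _ => ?_
  rw [incidence, ← Finsupp.singleAddHom_apply, map_sum]
  refine Finset.sum_congr rfl fun x _ => ?_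
  split_ifs
  · simp [redBefore]
  · simp

end LinkDiagram

/-! ### Combinatorics of a ladder and of its red steps -/

namespace LinkDiagram

namespace LadderGrouping

variable {D : LinkDiagram} {s : D.State} {k : ℕ} (G : D.LadderGrouping s k)

/-- The crossing of the `a`-th step of the `l`-th ladder. -/
def stepAt (l : Fin k) (a : Fin (G.height l)) : D.Crossing := (G.ladder l).step a

/-- The darts at the `a`-th step of the `l`-th ladder: `0, 1` are below the step, `2, 3` are above
it, and `0, 3` lie on the same rail. -/
def dart (l : Fin k) (a : Fin (G.height l)) (j : Fin 4) : D.Dart := rot ((G.ladder l).bottom a) j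

theorem height_pos (l : Fin k) : 0 < G.height l := (G.ladder l).height_pos

theorem dart_fst (l : Fin k) (a : Fin (G.height l)) (j : Fin 4) :
    (G.dart l a j).1 = G.stepAt l a := rfl

theorem stepAt_blue (l : Fin k) (a : Fin (G.height l)) : s (G.stepAt l a) = Label.A :=
  (G.ladder l).blue a

theorem stepAt_injective :
    Function.Injective fun p : Σ l, Fin (G.height l) => G.stepAt p.1 p.2 := by
  intro p q h
  exact (G.existsUnique _ (G.stepAt_blue p.1 p.2)).unique rfl h.symm

theorem exists_stepAt {c : D.Crossing} (hc : s c = Label.A) : ∃ l a, G.stepAt l a = c := by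
  obtain ⟨p, hp, -⟩ := G.existsUnique c hc
  exact ⟨p.1, p.2, hp⟩

theorem stepAt_inj {l : Fin k} {a a' : Fin (G.height l)} :
    G.stepAt l a = G.stepAt l a' ↔ a = a' := by
  refine ⟨fun h => ?_, fun h => h ▸ rfl⟩
  have := @stepAt_injective _ _ _ G ⟨l, a⟩ ⟨l, a'⟩ h
  simpa using this

theorem dart_injective (l : Fin k) :
    Function.Injective fun q : Fin (G.height l) × Fin 4 =>
      (Sum.inl (G.dart l q.1 q.2) : D.Dart ⊕ D.Loop) := by
  rintro ⟨a, j⟩ ⟨a', j'⟩ h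
  have h : G.dart l a j = G.dart l a' j' := Sum.inl_injective h
  have h0 := congrArg Prod.fst h
  have h1 : a = a' := G.stepAt_inj.1 h0
  subst h1
  have h2 := congrArg Prod.snd h
  simp only [dart, rot, add_right_inj] at h2
  rw [h2]

theorem exists_dart (l : Fin k) (a : Fin (G.height l)) (d : D.Dart) (h : d.1 = G.stepAt l a) :
    ∃ j, G.dart l a j = d :=
  ⟨d.2 - ((G.ladder l).bottom a).2, Prod.ext h.symm (by simp [dart, rot])⟩

theorem edge_dart_zero {l : Fin k} {a b : Fin (G.height l)} (h : (b : ℕ) = a + 1) :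
    D.edge (G.dart l a 0) = G.dart l b 3 := by
  have h1 := ((G.ladder l).parallel a b h).1
  simp only [dart, rot, add_zero] at h1 ⊢
  rw [h1, add_assoc]
  rfl

theorem edge_dart_two {l : Fin k} {a b : Fin (G.height l)} (h : (b : ℕ) = a + 1) :
    D.edge (G.dart l b 2) = G.dart l a 1 :=
  ((G.ladder l).parallel a b h).2.1

theorem edge_dart_one {l : Fin k} {a b : Fin (G.height l)} (h : (b : ℕ) = a + 1) :
    D.edge (G.dart l a 1) = G.dart l b 2 := by
  rw [← G.edge_dart_two h, D.edge_edge]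

theorem edge_dart_three {l : Fin k} {a b : Fin (G.height l)} (h : (b : ℕ) = a + 1) :
    D.edge (G.dart l b 3) = G.dart l a 0 := by
  rw [← G.edge_dart_zero h, D.edge_edge]

/-- The corner below a step starts at dart 1 or 3, and an odd rotation exchanges the two smoothing
patterns. In ladder coordinates a red step cuts across the ladder, while at a blue step the arcs
follow the rails. -/
theorem partner_dart_red {t : D.State} {l : Fin k} {a : Fin (G.height l)}
    (h : t (G.stepAt l a) = Label.B) (j : Fin 4) :
    partner t (G.dart l a j) = G.dart l a (![1, 0, 3, 2] j) := by
  rw [partner_of_B (by rw [dart_fst, h])]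
  refine Prod.ext rfl ?_
  rcases (G.ladder l).isSide a with h | h <;> simp only [dart, rot, h] <;> fin_cases j <;> rfl

theorem partner_dart_blue {t : D.State} {l : Fin k} {a : Fin (G.height l)}
    (h : t (G.stepAt l a) = Label.A) (j : Fin 4) :
    partner t (G.dart l a j) = G.dart l a (![3, 2, 1, 0] j) := by
  rw [partner_of_A (by rw [dart_fst, h])]
  refine Prod.ext rfl ?_
  rcases (G.ladder l).isSide a with h | h <;> simp only [dart, rot, h] <;> fin_cases j <;> rfl

/-- Translates between the darts 0 and 2 used by `IsBichord` and ladder coordinates; which one lies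
below depends on the position of the corner. -/
theorem circleOf_crossing_red {t : D.State} {l : Fin k} {a : Fin (G.height l)}
    (h : t (G.stepAt l a) = Label.B) :
    (circleOf t (Sum.inl (G.stepAt l a, 0)) = circleOf t (Sum.inl (G.dart l a 0)) ∧
        circleOf t (Sum.inl (G.stepAt l a, 2)) = circleOf t (Sum.inl (G.dart l a 2))) ∨
      (circleOf t (Sum.inl (G.stepAt l a, 0)) = circleOf t (Sum.inl (G.dart l a 2)) ∧
        circleOf t (Sum.inl (G.stepAt l a, 2)) = circleOf t (Sum.inl (G.dart l a 0))) := by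
  have h0 := circleOf_B_zero h
  have h2 := circleOf_B_two h
  have e : ∀ j, G.dart l a j = (G.stepAt l a, ((G.ladder l).bottom a).2 + j) := fun _ => rfl
  rcases (G.ladder l).isSide a with hs | hs <;> simp only [e, hs]
  · exact Or.inr ⟨h0.symm, h2.symm⟩
  · exact Or.inl ⟨h0.symm, h2.symm⟩

/-! ### Reddened states -/

variable (M : ∀ l, Finset (Fin (G.height l)))

theorem redden_stepAt_eq_B {l : Fin k} {a : Fin (G.height l)} :
    G.redden M (G.stepAt l a) = Label.B ↔ a ∈ M l := by
  classical
  have hblue := G.stepAt_blue l a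
  constructor
  · intro h
    by_contra ha
    rw [redden, if_neg, hblue] at h
    · cases h
    · rintro ⟨l', a', ha', h'⟩
      have := @stepAt_injective _ _ _ G ⟨l', a'⟩ ⟨l, a⟩ h'
      cases this
      exact ha ha'
  · intro h
    exact if_pos ⟨l, a, h, rfl⟩

theorem redden_stepAt_eq_A {l : Fin k} {a : Fin (G.height l)} :
    G.redden M (G.stepAt l a) = Label.A ↔ a ∉ M l := by
  rw [← redden_stepAt_eq_B]
  cases G.redden M (G.stepAt l a) <;> simp

theorem redden_of_red {c : D.Crossing} (hc : s c = Label.B) : G.redden M c = Label.B := by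
  classical
  unfold redden
  split_ifs
  · rfl
  · exact hc

/-- Changing one more step into red. -/
def addStep (l : Fin k) (a : Fin (G.height l)) : ∀ l, Finset (Fin (G.height l)) :=
  Function.update M l (insert a (M l))

theorem redden_addStep (l : Fin k) (a : Fin (G.height l)) :
    G.redden (G.addStep M l a) = Function.update (G.redden M) (G.stepAt l a) Label.B := by
  funext c
  cases hc : s c
  · obtain ⟨l', a', rfl⟩ := G.exists_stepAt hc
    by_cases h : G.stepAt l' a' = G.stepAt l a
    · have := @stepAt_injective _ _ _ G ⟨l', a'⟩ ⟨l, a⟩ h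
      cases this
      rw [Function.update_self, redden_stepAt_eq_B, addStep, Function.update_self]
      exact Finset.mem_insert_self _ _
    · rw [Function.update_of_ne h]
      have key : a' ∈ G.addStep M l a l' ↔ a' ∈ M l' := by
        by_cases hl : l' = l
        · subst hl
          have : a' ≠ a := fun h' => h (by rw [h'])
          simp [addStep, this]
        · simp [addStep, hl]
      by_cases hm : a' ∈ M l'
      · rw [(G.redden_stepAt_eq_B M).2 hm, G.redden_stepAt_eq_B, key]
        exact hm
      · rw [(G.redden_stepAt_eq_A M).2 hm, G.redden_stepAt_eq_A, key]
        exact hm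
  · have : c ≠ G.stepAt l a := by
      rintro rfl
      rw [G.stepAt_blue] at hc
      cases hc
    rw [Function.update_of_ne this, redden_of_red _ _ hc, redden_of_red _ _ hc]

/-! ### The circles between the steps of a ladder -/

/-- The number of red steps among the first `n` ones. -/
def redCount (l : Fin k) (n : ℕ) : ℕ := ((M l).filter fun a : Fin (G.height l) => (a : ℕ) < n).card

theorem redCount_zero (l : Fin k) : G.redCount M l 0 = 0 := by simp [redCount]

theorem redCount_succ_of_mem {l : Fin k} {a : Fin (G.height l)} (h : a ∈ M l) :
    G.redCount M l (a + 1) = G.redCount M l a + 1 := by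
  unfold redCount
  have : ((M l).filter fun b : Fin (G.height l) => (b : ℕ) < a + 1) =
      insert a ((M l).filter fun b : Fin (G.height l) => (b : ℕ) < a) := by
    ext b
    simp only [Finset.mem_filter, Finset.mem_insert, Fin.ext_iff]
    constructor
    · rintro ⟨h1, h2⟩
      by_cases h3 : (b : ℕ) = a
      · exact Or.inl h3
      · exact Or.inr ⟨h1, by omega⟩
    · rintro (h1 | h1)
      · obtain rfl := Fin.ext h1
        exact ⟨h, by omega⟩
      · exact ⟨h1.1, by omega⟩
  rw [this, Finset.card_insert_of_notMem (by simp)]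

theorem redCount_succ_of_notMem {l : Fin k} {a : Fin (G.height l)} (h : a ∉ M l) :
    G.redCount M l (a + 1) = G.redCount M l a := by
  unfold redCount
  congr 1
  refine Finset.filter_congr fun b hb => ?_
  have : b ≠ a := fun h' => h (h' ▸ hb)
  rw [Ne, Fin.ext_iff] at this
  omega

theorem redCount_le (l : Fin k) (n : ℕ) : G.redCount M l n ≤ (M l).card :=
  Finset.card_filter_le _ _

theorem redCount_height (l : Fin k) : G.redCount M l (G.height l) = (M l).card := by
  unfold redCount
  rw [Finset.filter_true_of_mem fun a _ => a.2]

/-- On the small circles between consecutive red steps, the number of red steps above; elsewhere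
`0`. -/
noncomputable def depth (l : Fin k) : D.Dart ⊕ D.Loop → ℕ :=
  Function.extend (fun q : Fin (G.height l) × Fin 4 => Sum.inl (G.dart l q.1 q.2))
    (fun q =>
      let c := G.redCount M l (q.1 + if q.2 = 0 ∨ q.2 = 1 then 1 else 0)
      if c < (M l).card then c else 0) 0

theorem depth_dart (l : Fin k) (a : Fin (G.height l)) (j : Fin 4) :
    G.depth M l (Sum.inl (G.dart l a j)) =
      if G.redCount M l (a + if j = 0 ∨ j = 1 then 1 else 0) < (M l).card then
        G.redCount M l (a + if j = 0 ∨ j = 1 then 1 else 0) else 0 :=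
  (G.dart_injective l).extend_apply _ _ (a, j)

theorem depth_eq_zero {l : Fin k} {p : D.Dart ⊕ D.Loop}
    (h : ∀ a j, p ≠ Sum.inl (G.dart l a j)) : G.depth M l p = 0 :=
  Function.extend_apply' _ _ _ (by rintro ⟨q, hq⟩; exact h _ _ hq.symm)

/-- Edges leaving the ladder cause no trouble because `depth` vanishes at both ends: no red step
lies above the top, and at the bottom the full count is replaced by `0`. All other edges are rails
between neighbouring steps. -/
theorem depth_edge_of_ne_zero {l : Fin k} {d : D.Dart} (h : G.depth M l (Sum.inl d) ≠ 0) :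
    G.depth M l (Sum.inl (D.edge d)) = G.depth M l (Sum.inl d) := by
  by_cases hd : ∃ a j, d = G.dart l a j
  · obtain ⟨a, j, rfl⟩ := hd
    by_cases hj : j = 0 ∨ j = 1
    · have ha : (a : ℕ) + 1 < G.height l := by
        by_contra hcon
        refine h ?_
        rw [depth_dart, if_pos hj, if_neg]
        rw [show (a : ℕ) + 1 = G.height l by omega, redCount_height]
        exact lt_irrefl _
      rcases hj with rfl | rfl
      · rw [G.edge_dart_zero (b := ⟨a + 1, ha⟩) rfl, depth_dart, depth_dart]
        simp
      · rw [G.edge_dart_one (b := ⟨a + 1, ha⟩) rfl, depth_dart, depth_dart]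
        simp
    · have ha : 0 < (a : ℕ) := by
        by_contra hcon
        refine h ?_
        rw [depth_dart, if_neg hj, show (a : ℕ) + 0 = 0 by omega, redCount_zero]
        simp
      have hab : (a : ℕ) = (⟨a - 1, by omega⟩ : Fin (G.height l)) + 1 := by
        simp only; omega
      have hj' : j = 2 ∨ j = 3 := by omega
      rcases hj' with rfl | rfl
      · rw [G.edge_dart_two hab, depth_dart, depth_dart]
        simp only [Fin.isValue, or_true, if_true, ← hab]
        simp
      · rw [G.edge_dart_three hab, depth_dart, depth_dart]
        simp only [Fin.isValue, true_or, if_true, ← hab]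
        simp
  · refine absurd (G.depth_eq_zero M fun a j hj => hd ⟨a, j, Sum.inl_injective hj⟩) h

theorem depth_edge (l : Fin k) (d : D.Dart) :
    G.depth M l (Sum.inl (D.edge d)) = G.depth M l (Sum.inl d) := by
  by_cases h : G.depth M l (Sum.inl d) = 0
  · by_contra hne
    rw [h] at hne
    have := G.depth_edge_of_ne_zero M hne
    rw [D.edge_edge, h] at this
    exact hne this.symm
  · exact G.depth_edge_of_ne_zero M h

theorem depth_partner (l : Fin k) (d : D.Dart) :
    G.depth M l (Sum.inl (partner (G.redden M) d)) = G.depth M l (Sum.inl d) := by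
  by_cases hd : ∃ a, d.1 = G.stepAt l a
  · obtain ⟨a, ha⟩ := hd
    obtain ⟨j, rfl⟩ := G.exists_dart l a d ha
    by_cases hm : a ∈ M l
    · rw [G.partner_dart_red ((G.redden_stepAt_eq_B M).2 hm), depth_dart, depth_dart]
      fin_cases j <;> simp
    · rw [G.partner_dart_blue ((G.redden_stepAt_eq_A M).2 hm), depth_dart, depth_dart]
      fin_cases j <;> simp [G.redCount_succ_of_notMem M hm]
  · rw [G.depth_eq_zero, G.depth_eq_zero]
    · rintro a j h
      exact hd ⟨a, by rw [Sum.inl_injective h, dart_fst]⟩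
    · rintro a j h
      exact hd ⟨a, by rw [← partner_fst (G.redden M) d, Sum.inl_injective h, dart_fst]⟩

theorem depth_eq_of_circleOf_eq (l : Fin k) {p q : D.Dart ⊕ D.Loop}
    (h : circleOf (G.redden M) p = circleOf (G.redden M) q) :
    G.depth M l p = G.depth M l q :=
  eq_of_circleOf_eq (G.depth M l) (G.depth_edge M l) (G.depth_partner M l) h

variable {M}

/-- The counts are c above and c + 1 below, the latter read as `0` when it is the full count. In
that case c is at least 1, thanks to the second red step; with a single red step both depths would
be `0`. -/
theorem depth_above_ne_below {l : Fin k} {a : Fin (G.height l)} (ha : a ∈ M l)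
    (hM : 2 ≤ (M l).card) :
    G.depth M l (Sum.inl (G.dart l a 0)) ≠ G.depth M l (Sum.inl (G.dart l a 2)) := by
  rw [depth_dart, depth_dart]
  have h1 := G.redCount_succ_of_mem M ha
  have h2 := G.redCount_le M l (a + 1)
  simp only [Fin.isValue, true_or, if_true]
  rw [h1, if_neg (by decide : ¬ ((2 : Fin 4) = 0 ∨ (2 : Fin 4) = 1)), add_zero]
  split_ifs <;> omega

theorem isBichord_stepAt {l : Fin k} {a : Fin (G.height l)} (ha : a ∈ M l)
    (hM : 2 ≤ (M l).card) : IsBichord (G.redden M) (G.stepAt l a) := by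
  have key : circleOf (G.redden M) (Sum.inl (G.dart l a 0)) ≠
      circleOf (G.redden M) (Sum.inl (G.dart l a 2)) := fun h =>
    G.depth_above_ne_below ha hM (G.depth_eq_of_circleOf_eq M l h)
  unfold IsBichord
  rcases G.circleOf_crossing_red ((G.redden_stepAt_eq_B M).2 ha) with ⟨h0, h2⟩ | ⟨h0, h2⟩
  · rwa [h0, h2]
  · rw [h0, h2]; exact key.symm

theorem addStep_self (l : Fin k) (a : Fin (G.height l)) :
    G.addStep M l a l = insert a (M l) := by simp [addStep]

theorem addStep_of_ne {l l' : Fin k} (h : l' ≠ l) (a : Fin (G.height l)) :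
    G.addStep M l a l' = M l' := by simp [addStep, h]

theorem isBichord_addStep {l : Fin k} {a : Fin (G.height l)} (ha : a ∉ M l)
    (hM : (M l).Nonempty) :
    IsBichord (Function.update (G.redden M) (G.stepAt l a) Label.B) (G.stepAt l a) := by
  rw [← redden_addStep]
  refine G.isBichord_stepAt (by simp [addStep_self]) ?_
  rw [addStep_self, Finset.card_insert_of_notMem ha]
  have := hM.card_pos
  omega

/-! ### Points off the small circles -/

/-- Points which never lie on the small circles between consecutive red steps. -/
def IsOuter (p : D.Dart ⊕ D.Loop) : Prop :=
  ∀ M : ∀ l, Finset (Fin (G.height l)), ∀ l, G.depth M l p = 0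

theorem isOuter_of_red {c : D.Crossing} (hc : s c = Label.B) (i : Fin 4) :
    G.IsOuter (Sum.inl (c, i)) := by
  intro M l
  refine G.depth_eq_zero M fun a j h => ?_
  have : c = G.stepAt l a := congrArg Prod.fst (Sum.inl_injective h)
  rw [this, G.stepAt_blue] at hc
  cases hc

theorem topEnd_eq (l : Fin k) : (G.ladder l).topEnd = G.dart l ⟨0, G.height_pos l⟩ 2 := rfl

theorem bottomEnd_eq (l : Fin k) :
    (G.ladder l).bottomEnd = G.dart l ⟨G.height l - 1, Nat.sub_one_lt_of_lt (G.height_pos l)⟩ 0 := by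
  simp only [dart, rot, add_zero]
  rfl

theorem depth_of_ne {l l' : Fin k} (h : l' ≠ l) (a : Fin (G.height l)) (j : Fin 4) :
    G.depth M l' (Sum.inl (G.dart l a j)) = 0 := by
  refine G.depth_eq_zero M fun a' j' h' => h ?_
  have h0 := congrArg Prod.fst (Sum.inl_injective h')
  have := @stepAt_injective _ _ _ G ⟨l, a⟩ ⟨l', a'⟩ h0
  exact (congrArg Sigma.fst this).symm

theorem isOuter_topEnd (l : Fin k) : G.IsOuter (Sum.inl (G.ladder l).topEnd) := by
  intro M l'
  rw [topEnd_eq]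
  by_cases h : l' = l
  · subst h
    rw [depth_dart]
    simp [redCount_zero]
  · exact G.depth_of_ne h _ _

theorem isOuter_bottomEnd (l : Fin k) : G.IsOuter (Sum.inl (G.ladder l).bottomEnd) := by
  intro M l'
  rw [bottomEnd_eq]
  by_cases h : l' = l
  · subst h
    rw [depth_dart]
    have := G.height_pos l'
    simp only [Fin.isValue, true_or, if_true, Nat.sub_add_cancel this, redCount_height]
    simp
  · exact G.depth_of_ne h _ _

/-- The two halves of the split circle have different depths, whereas outer points have depth `0`;
so two outer points cannot end up on different halves. -/
theorem circleOf_addStep_iff {l : Fin k} {a : Fin (G.height l)} (ha : a ∉ M l)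
    (hM : (M l).Nonempty) {p q : D.Dart ⊕ D.Loop} (hp : G.IsOuter p) (hq : G.IsOuter q) :
    circleOf (G.redden (G.addStep M l a)) p = circleOf (G.redden (G.addStep M l a)) q ↔
      circleOf (G.redden M) p = circleOf (G.redden M) q := by
  have hb := G.isBichord_addStep ha hM
  have hA := (G.redden_stepAt_eq_A M).2 ha
  have hmem : a ∈ G.addStep M l a l := by simp [addStep_self]
  have hcard : 2 ≤ (G.addStep M l a l).card := by
    rw [addStep_self, Finset.card_insert_of_notMem ha]
    have := hM.card_pos
    omega
  have hne := G.depth_above_ne_below hmem hcard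
  have hred := G.circleOf_crossing_red ((G.redden_stepAt_eq_B _).2 hmem)
  rw [redden_addStep] at hred
  constructor
  · intro h
    rw [redden_addStep] at h
    exact circleOf_eq_of_update hA hb h
  · intro h
    rcases circleOf_update_of_eq (x := G.stepAt l a) h with h | ⟨h1, h2⟩
    · rwa [redden_addStep]
    · have h1' : circleOf (G.redden (G.addStep M l a)) p =
            circleOf (G.redden (G.addStep M l a)) (Sum.inl (G.dart l a 0)) ∨
          circleOf (G.redden (G.addStep M l a)) p =
            circleOf (G.redden (G.addStep M l a)) (Sum.inl (G.dart l a 2)) := by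
        rw [redden_addStep]
        rcases hred with ⟨e0, e2⟩ | ⟨e0, e2⟩ <;> rw [e0, e2] at h1 <;> tauto
      have h2' : circleOf (G.redden (G.addStep M l a)) q =
            circleOf (G.redden (G.addStep M l a)) (Sum.inl (G.dart l a 0)) ∨
          circleOf (G.redden (G.addStep M l a)) q =
            circleOf (G.redden (G.addStep M l a)) (Sum.inl (G.dart l a 2)) := by
        rw [redden_addStep]
        rcases hred with ⟨e0, e2⟩ | ⟨e0, e2⟩ <;> rw [e0, e2] at h2 <;> tauto
      have dp := hp (G.addStep M l a) l
      have dq := hq (G.addStep M l a) l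
      rcases h1' with h1 | h1 <;> rcases h2' with h2 | h2
      · rw [h1, h2]
      · have e1 := G.depth_eq_of_circleOf_eq _ l h1
        have e2 := G.depth_eq_of_circleOf_eq _ l h2
        omega
      · have e1 := G.depth_eq_of_circleOf_eq _ l h1
        have e2 := G.depth_eq_of_circleOf_eq _ l h2
        omega
      · rw [h1, h2]

/-- Reddening further steps one by one. -/
theorem redden_induction {P : (∀ l, Finset (Fin (G.height l))) → Prop}
    (huniv : P fun _ => Finset.univ)
    (hstep : ∀ M : ∀ l, Finset (Fin (G.height l)), (∀ l, (M l).Nonempty) →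
      ∀ l a, a ∉ M l → P (G.addStep M l a) → P M)
    (M : ∀ l, Finset (Fin (G.height l))) (hM : ∀ l, (M l).Nonempty) : P M := by
  induction hn : ∑ l, ((M l)ᶜ).card using Nat.strong_induction_on generalizing M with
  | _ n ih =>
    by_cases h : ∃ l a, a ∉ M l
    · obtain ⟨l, a, ha⟩ := h
      refine hstep M hM l a ha (ih _ ?_ (G.addStep M l a) ?_ rfl)
      · rw [← hn]
        refine Finset.sum_lt_sum (fun l' _ => ?_) ⟨l, Finset.mem_univ _, ?_⟩
        · by_cases hl : l' = l
          · subst hl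
            rw [addStep_self]
            exact Finset.card_le_card (Finset.compl_subset_compl.2 (Finset.subset_insert _ _))
          · rw [G.addStep_of_ne hl]
        · rw [addStep_self]
          exact Finset.card_lt_card (Finset.compl_ssubset_compl.2 (Finset.ssubset_insert ha))
      · intro l'
        by_cases hl : l' = l
        · subst hl
          rw [addStep_self]
          exact Finset.insert_nonempty _ _
        · rw [G.addStep_of_ne hl]
          exact hM l'
    · push Not at h
      have : M = fun _ => Finset.univ := by
        funext l
        exact Finset.eq_univ_of_forall (h l)
      rwa [this]

theorem circleOf_redden_iff (hM : ∀ l, (M l).Nonempty) {p q : D.Dart ⊕ D.Loop}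
    (hp : G.IsOuter p) (hq : G.IsOuter q) :
    circleOf (G.redden M) p = circleOf (G.redden M) q ↔
      circleOf (G.redden fun _ => Finset.univ) p =
        circleOf (G.redden fun _ => Finset.univ) q := by
  refine G.redden_induction (P := fun M => circleOf (G.redden M) p = circleOf (G.redden M) q ↔ _)
    Iff.rfl ?_ M hM
  intro M hM l a ha h
  exact (G.circleOf_addStep_iff ha (hM l) hp hq).symm.trans h

/-- Each further red step adds one circle. -/
theorem card_circle_redden (hM : ∀ l, (M l).Nonempty) :
    Fintype.card (Circle (G.redden M)) + ∑ l, G.height l =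
      Fintype.card (Circle (G.redden fun _ => Finset.univ)) + ∑ l, (M l).card := by
  refine G.redden_induction (P := fun M => Fintype.card (Circle (G.redden M)) + ∑ l, G.height l =
    Fintype.card (Circle (G.redden fun _ => Finset.univ)) + ∑ l, (M l).card) ?_ ?_ M hM
  · simp
  intro M hM l a ha h
  have h1 := card_circle_update ((G.redden_stepAt_eq_A M).2 ha) (G.isBichord_addStep ha (hM l))
  rw [redden_addStep, h1] at h
  have h2 : ∑ l', (G.addStep M l a l').card = ∑ l', (M l').card + 1 := by
    rw [← Finset.add_sum_erase _ _ (Finset.mem_univ l),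
      ← Finset.add_sum_erase _ (fun l => (M l).card) (Finset.mem_univ l), addStep_self,
      Finset.card_insert_of_notMem ha, Finset.sum_congr rfl (g := fun l => (M l).card)]
    · ring
    · intro l' hl'
      rw [G.addStep_of_ne (Finset.ne_of_mem_erase hl')]
  omega

/-- Carries the hypothesis on the red scars from the broken state to every state with a red step in
each ladder: the ends of these scars are outer points. -/
theorem isBichord_redden (hM : ∀ l, (M l).Nonempty) {N : ∀ l, Finset (Fin (G.height l))}
    (hN : ∀ l, (N l).Nonempty) {c : D.Crossing} (hc : s c = Label.B)
    (h : IsBichord (G.redden N) c) : IsBichord (G.redden M) c := by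
  unfold IsBichord at *
  rw [Ne, G.circleOf_redden_iff hM (G.isOuter_of_red hc _) (G.isOuter_of_red hc _)]
  rwa [Ne, G.circleOf_redden_iff hN (G.isOuter_of_red hc _) (G.isOuter_of_red hc _)] at h

theorem circleOf_topEnd_eq_bottomEnd (hM : ∀ l, (M l).Nonempty) {l : Fin k}
    (hl : G.peripheryNumber l = 1) :
    circleOf (G.redden M) (Sum.inl (G.ladder l).topEnd) =
      circleOf (G.redden M) (Sum.inl (G.ladder l).bottomEnd) := by
  rw [G.circleOf_redden_iff hM (G.isOuter_topEnd l) (G.isOuter_bottomEnd l)]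
  by_contra hne
  rw [peripheryNumber, Set.ncard_pair hne] at hl
  omega

/-! ### Levels of a ladder -/

theorem circleOf_dart_two_iff (l : Fin k) (a : Fin (G.height l)) :
    circleOf (G.redden M) (Sum.inl (G.dart l a 2)) =
        circleOf (G.redden M) (Sum.inl (G.dart l a 3)) ↔
      circleOf (G.redden M) (Sum.inl (G.dart l a 0)) =
        circleOf (G.redden M) (Sum.inl (G.dart l a 1)) := by
  by_cases hm : a ∈ M l
  · have h := G.partner_dart_red ((G.redden_stepAt_eq_B M).2 hm)
    have h0 := circleOf_partner (G.redden M) (G.dart l a 0)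
    have h2 := circleOf_partner (G.redden M) (G.dart l a 2)
    rw [h] at h0 h2
    exact iff_of_true h2.symm h0.symm
  · have h := G.partner_dart_blue ((G.redden_stepAt_eq_A M).2 hm)
    have h0 : circleOf (G.redden M) (Sum.inl (G.dart l a 3)) = _ :=
      h 0 ▸ circleOf_partner (G.redden M) (G.dart l a 0)
    have h1 : circleOf (G.redden M) (Sum.inl (G.dart l a 2)) = _ :=
      h 1 ▸ circleOf_partner (G.redden M) (G.dart l a 1)
    rw [h0, h1, eq_comm]

/-- At a red step the two rails are joined by an arc, and having both rails on one circle passes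
from each level to the next. -/
theorem circleOf_dart_two_eq_three {l : Fin k} (hM : (M l).Nonempty) (a : Fin (G.height l)) :
    circleOf (G.redden M) (Sum.inl (G.dart l a 2)) =
        circleOf (G.redden M) (Sum.inl (G.dart l a 3)) := by
  have key : ∀ n (hn : n < G.height l),
      circleOf (G.redden M) (Sum.inl (G.dart l ⟨n, hn⟩ 2)) =
          circleOf (G.redden M) (Sum.inl (G.dart l ⟨n, hn⟩ 3)) ↔
        circleOf (G.redden M) (Sum.inl (G.dart l ⟨0, G.height_pos l⟩ 2)) =
          circleOf (G.redden M) (Sum.inl (G.dart l ⟨0, G.height_pos l⟩ 3)) := by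
    intro n
    induction n with
    | zero => exact fun _ => Iff.rfl
    | succ n ih =>
      intro hn
      rw [← ih (by omega), circleOf_dart_two_iff (a := ⟨n, _⟩),
        ← G.edge_dart_zero (a := ⟨n, by omega⟩) rfl, ← G.edge_dart_one (a := ⟨n, by omega⟩) rfl,
        circleOf_edge, circleOf_edge, eq_comm]
  obtain ⟨b, hb⟩ := hM
  refine (key a a.2).2 ((key b b.2).1 ?_)
  have h := circleOf_partner (G.redden M) (G.dart l b 2)
  rw [G.partner_dart_red ((G.redden_stepAt_eq_B M).2 hb)] at h
  exact h.symm

/-- A dart between the `n`-th and the preceding step, or at an end of the ladder. -/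
def level (l : Fin k) (n : ℕ) : D.Dart :=
  if h : n < G.height l then G.dart l ⟨n, h⟩ 2 else (G.ladder l).bottomEnd

theorem circleOf_level {l : Fin k} (a : Fin (G.height l)) :
    circleOf (G.redden M) (Sum.inl (G.level l a)) =
      circleOf (G.redden M) (Sum.inl (G.dart l a 2)) := by
  rw [level, dif_pos a.2]

theorem circleOf_level_succ {l : Fin k} (hM : (M l).Nonempty) (a : Fin (G.height l)) :
    circleOf (G.redden M) (Sum.inl (G.level l (a + 1))) =
      circleOf (G.redden M) (Sum.inl (G.dart l a 0)) := by
  unfold level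
  split_ifs with h
  · rw [← G.edge_dart_one (a := a) rfl, circleOf_edge]
    exact ((G.circleOf_dart_two_iff l a).1 (G.circleOf_dart_two_eq_three hM a)).symm
  · have : a = ⟨G.height l - 1, Nat.sub_one_lt_of_lt (G.height_pos l)⟩ :=
      Fin.ext (by have := a.2; simp only; omega)
    rw [bottomEnd_eq, ← this]

theorem circleOf_level_succ_of_notMem {l : Fin k} (hM : (M l).Nonempty) {a : Fin (G.height l)}
    (ha : a ∉ M l) :
    circleOf (G.redden M) (Sum.inl (G.level l (a + 1))) =
      circleOf (G.redden M) (Sum.inl (G.level l a)) := by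
  rw [G.circleOf_level_succ hM, G.circleOf_level, G.circleOf_dart_two_eq_three hM]
  have h := circleOf_partner (G.redden M) (G.dart l a 0)
  rw [G.partner_dart_blue ((G.redden_stepAt_eq_A M).2 ha)] at h
  exact h.symm

end LadderGrouping

end LinkDiagram

/-! ### Sums over the choices of red steps, and the chain V -/

namespace LinkDiagram

namespace LadderGrouping

variable {D : LinkDiagram} {s : D.State} {k : ℕ} (G : D.LadderGrouping s k)

/-- The choices of `μ l` steps of the `l`-th ladder, for each `l`. -/
def choices (μ : Fin k → ℕ) : Finset (∀ l, Finset (Fin (G.height l))) :=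
  Fintype.piFinset fun m => Finset.powersetCard (μ m) Finset.univ

/-- One more step for the `l`-th ladder. -/
def bump (μ : Fin k → ℕ) (l : Fin k) : Fin k → ℕ := Function.update μ l (μ l + 1)

theorem bump_apply (μ : Fin k → ℕ) (l m : Fin k) : bump μ l m = μ m + if m = l then 1 else 0 := by
  by_cases h : m = l
  · subst h; simp [bump]
  · simp [bump, h]

theorem bump_comm (μ : Fin k → ℕ) (l m : Fin k) : bump (bump μ l) m = bump (bump μ m) l := by
  funext n
  simp only [bump_apply]
  ring

theorem sum_Iio_bump (μ : Fin k → ℕ) (l m : Fin k) :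
    ∑ n ∈ Finset.Iio m, bump μ l n = ∑ n ∈ Finset.Iio m, μ n + if l < m then 1 else 0 := by
  simp only [bump_apply, Finset.sum_add_distrib, Finset.sum_ite_eq', Finset.mem_Iio]

variable {G} {M : ∀ l, Finset (Fin (G.height l))} {μ : Fin k → ℕ}

theorem mem_choices : M ∈ G.choices μ ↔ ∀ l, (M l).card = μ l := by
  simp [choices, Finset.mem_powersetCard]

theorem nonempty_of_mem_choices (hM : M ∈ G.choices μ) (hμ : ∀ l, 1 ≤ μ l) (l : Fin k) :
    (M l).Nonempty :=
  Finset.card_pos.1 (by rw [mem_choices.1 hM]; exact hμ l)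

variable (G M)

/-- Sums over the choices of a state and a blue step, and over the choices of a state and a red
step. -/
theorem sum_addStep {E : Type*} [AddCommMonoid E] (μ : Fin k → ℕ) (l : Fin k)
    (F : (∀ l, Finset (Fin (G.height l))) → Fin (G.height l) → E) :
    ∑ M ∈ G.choices μ, ∑ a ∈ (M l)ᶜ, F (G.addStep M l a) a =
      ∑ N ∈ G.choices (bump μ l), ∑ a ∈ N l, F N a := by
  rw [Finset.sum_sigma', Finset.sum_sigma']
  refine Finset.sum_bij' (fun p _ => ⟨G.addStep p.1 l p.2, p.2⟩)
    (fun p _ => ⟨Function.update p.1 l ((p.1 l).erase p.2), p.2⟩) ?_ ?_ ?_ ?_ ?_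
  · rintro ⟨M, a⟩ h
    simp only [Finset.mem_sigma, Finset.mem_compl, mem_choices] at h ⊢
    refine ⟨fun m => ?_, by simp [addStep_self]⟩
    by_cases hm : m = l
    · subst hm
      rw [addStep_self, Finset.card_insert_of_notMem h.2, h.1, bump_apply, if_pos rfl]
    · rw [G.addStep_of_ne hm, h.1, bump_apply, if_neg hm, add_zero]
  · rintro ⟨N, a⟩ h
    simp only [Finset.mem_sigma, Finset.mem_compl, mem_choices] at h ⊢
    refine ⟨fun m => ?_, by simp⟩
    have := h.1 m
    by_cases hm : m = l
    · subst hm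
      rw [bump_apply, if_pos rfl] at this
      rw [Function.update_self, Finset.card_erase_of_mem h.2, this, Nat.add_sub_cancel]
    · rw [bump_apply, if_neg hm, add_zero] at this
      rw [Function.update_of_ne hm, this]
  · rintro ⟨M, a⟩ h
    simp only [Finset.mem_sigma, Finset.mem_compl] at h
    simp [addStep, Finset.erase_insert h.2]
  · rintro ⟨N, a⟩ h
    simp only [Finset.mem_sigma] at h
    simp [addStep, Finset.insert_erase h.2]
  · rintro ⟨M, a⟩ _
    rfl

/-- The count is of steps strictly above `a`, so the sign can be read off the target state; this
permits regrouping by targets. -/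
theorem redCount_addStep (l : Fin k) (a : Fin (G.height l)) :
    G.redCount (G.addStep M l a) l a = G.redCount M l a := by
  unfold redCount
  rw [addStep_self, Finset.filter_insert, if_neg (lt_irrefl _)]

/-- The contributions of the steps of a ladder cancel out, except for those of its ends. -/
theorem sum_steps {E : Type*} [AddCommGroup E] {l : Fin k} (hM : (M l).Nonempty)
    (g : D.Dart ⊕ D.Loop → E)
    (hg : ∀ p q, circleOf (G.redden M) p = circleOf (G.redden M) q → g p = g q) :
    ∑ a ∈ M l, (-1 : ℤ) ^ G.redCount M l a •
        (g (Sum.inl (G.dart l a 0)) + g (Sum.inl (G.dart l a 2))) =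
      g (Sum.inl (G.ladder l).topEnd) -
        (-1 : ℤ) ^ (M l).card • g (Sum.inl (G.ladder l).bottomEnd) := by
  -- Telescoping by levels: a blue step changes neither the circle nor the sign, and a red step
  -- cancels the circle above it and brings in the one below with the opposite sign.
  have key : ∀ n ≤ G.height l, ∑ a ∈ (M l).filter (fun a : Fin (G.height l) => (a : ℕ) < n),
      (-1 : ℤ) ^ G.redCount M l a •
        (g (Sum.inl (G.dart l a 0)) + g (Sum.inl (G.dart l a 2))) =
      g (Sum.inl (G.level l 0)) - (-1 : ℤ) ^ G.redCount M l n • g (Sum.inl (G.level l n)) := by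
    intro n
    induction n with
    | zero => simp [redCount_zero]
    | succ n ih =>
      intro hn
      let a : Fin (G.height l) := ⟨n, hn⟩
      have hsplit : (M l).filter (fun b : Fin (G.height l) => (b : ℕ) < n + 1) =
          if a ∈ M l then insert a ((M l).filter fun b : Fin (G.height l) => (b : ℕ) < n)
          else (M l).filter fun b : Fin (G.height l) => (b : ℕ) < n := by
        ext b
        have hb : b = a ↔ (b : ℕ) = n := Fin.ext_iff
        split_ifs with ha
        · simp only [Finset.mem_filter, Finset.mem_insert]
          constructor
          · rintro ⟨h1, h2⟩
            by_cases h3 : (b : ℕ) = n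
            · exact Or.inl (hb.2 h3)
            · exact Or.inr ⟨h1, by omega⟩
          · rintro (h1 | h1)
            · exact ⟨h1 ▸ ha, by have := hb.1 h1; omega⟩
            · exact ⟨h1.1, by omega⟩
        · simp only [Finset.mem_filter]
          refine and_congr_right fun h => ?_
          have : (b : ℕ) ≠ n := fun h' => ha (hb.2 h' ▸ h)
          omega
      have e0 := hg _ _ (G.circleOf_level (M := M) a)
      have e1 := hg _ _ (G.circleOf_level_succ hM a)
      rw [hsplit]
      by_cases ha : a ∈ M l
      · rw [if_pos ha, Finset.sum_insert (by simp [a]), ih (by omega), ← e0, ← e1,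
          show G.redCount M l (n + 1) = _ from G.redCount_succ_of_mem M ha]
        simp only [a, pow_succ]
        module
      · have e2 := hg _ _ (G.circleOf_level_succ_of_notMem hM ha)
        rw [if_neg ha, ih (by omega),
          show G.redCount M l (n + 1) = _ from G.redCount_succ_of_notMem M ha]
        simp only [a] at e2 ⊢
        rw [e2]
  have h := key (G.height l) le_rfl
  rw [Finset.filter_true_of_mem fun a _ => a.2, redCount_height] at h
  have h0 : G.level l 0 = (G.ladder l).topEnd := dif_pos (G.height_pos l)
  have h1 : G.level l (G.height l) = (G.ladder l).bottomEnd := dif_neg (lt_irrefl _)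
  rwa [h0, h1] at h

/-- The sum of the contributions of all ways to change one more step into red. -/
theorem sum_choices_addStep {E : Type*} [AddCommGroup E] (hμ : ∀ l, 1 ≤ μ l)
    (hper : ∀ l, μ l < G.height l → G.peripheryNumber l = 1)
    (g : (∀ l, Finset (Fin (G.height l))) → D.Dart ⊕ D.Loop → E)
    (hg : ∀ M p q, circleOf (G.redden M) p = circleOf (G.redden M) q → g M p = g M q) :
    ∑ M ∈ G.choices μ, ∑ l, ∑ a ∈ (M l)ᶜ,
        (-1 : ℤ) ^ (∑ m ∈ Finset.Iio l, (M m).card + G.redCount M l a) •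
          (g (G.addStep M l a) (Sum.inl (G.dart l a 0)) +
            g (G.addStep M l a) (Sum.inl (G.dart l a 2))) =
      ∑ l with Even (μ l) ∧ μ l < G.height l, (2 : ℤ) • (-1 : ℤ) ^ (∑ m ∈ Finset.Iio l, μ m) •
        ∑ N ∈ G.choices (bump μ l), g N (Sum.inl (G.ladder l).topEnd) := by
  rw [Finset.sum_comm, Finset.sum_filter]
  refine Finset.sum_congr rfl fun l _ => ?_
  have h1 : ∀ M ∈ G.choices μ, ∀ a ∈ (M l)ᶜ,
      (-1 : ℤ) ^ (∑ m ∈ Finset.Iio l, (M m).card + G.redCount M l a) •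
          (g (G.addStep M l a) (Sum.inl (G.dart l a 0)) +
            g (G.addStep M l a) (Sum.inl (G.dart l a 2))) =
      (-1 : ℤ) ^ (∑ m ∈ Finset.Iio l, μ m) • (-1 : ℤ) ^ G.redCount (G.addStep M l a) l a •
          (g (G.addStep M l a) (Sum.inl (G.dart l a 0)) +
            g (G.addStep M l a) (Sum.inl (G.dart l a 2))) := by
    intro M hM a _
    rw [redCount_addStep, pow_add, mul_smul]
    simp only [mem_choices.1 hM]
  rw [Finset.sum_congr rfl fun M hM => Finset.sum_congr rfl (h1 M hM),
    G.sum_addStep μ l fun N a => (-1 : ℤ) ^ (∑ m ∈ Finset.Iio l, μ m) •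
      (-1 : ℤ) ^ G.redCount N l a •
        (g N (Sum.inl (G.dart l a 0)) + g N (Sum.inl (G.dart l a 2)))]
  simp only [← Finset.smul_sum]
  by_cases hl : μ l < G.height l
  · have h2 : ∀ N ∈ G.choices (bump μ l), ∑ a ∈ N l, (-1 : ℤ) ^ G.redCount N l a •
        (g N (Sum.inl (G.dart l a 0)) + g N (Sum.inl (G.dart l a 2))) =
        (1 - (-1 : ℤ) ^ (μ l + 1)) • g N (Sum.inl (G.ladder l).topEnd) := by
      intro N hN
      have hne : ∀ m, (N m).Nonempty :=
        nonempty_of_mem_choices hN fun m => by rw [bump_apply]; have := hμ m; omega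
      rw [G.sum_steps N (hne l) (g N) (hg N),
        ← hg N _ _ (G.circleOf_topEnd_eq_bottomEnd hne (hper l hl)), mem_choices.1 hN, bump_apply,
        if_pos rfl, sub_smul, one_smul]
    rw [Finset.sum_congr rfl h2, ← Finset.smul_sum]
    -- The target has `μ l + 1` red steps in this ladder, so 1 - (-1)^(μ l + 1) is 2 for even `μ l`
    -- and 0 for odd.
    by_cases he : Even (μ l)
    · rw [if_pos ⟨he, hl⟩, pow_succ, he.neg_one_pow, smul_comm]
      norm_num
    · rw [if_neg fun h => he h.1, pow_succ, (Nat.not_even_iff_odd.1 he).neg_one_pow]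
      simp
  -- A fully red ladder offers no further step, so it contributes nothing, whatever its periphery
  -- number.
  · have hempty : G.choices (bump μ l) = ∅ := by
      refine Finset.eq_empty_of_forall_notMem fun N hN => hl ?_
      have h3 := mem_choices.1 hN l
      rw [bump_apply, if_pos rfl] at h3
      have h4 := Finset.card_le_univ (N l)
      rw [Fintype.card_fin] at h4
      omega
    rw [hempty, if_neg fun h => hl h.2]
    simp

/-! ### The differential on the reddened states -/

theorem sum_crossing {E : Type*} [AddCommMonoid E] (F : D.Crossing → E)
    (hF : ∀ c, G.redden M c = Label.B → F c = 0) :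
    ∑ c, F c = ∑ l, ∑ a ∈ (M l)ᶜ, F (G.stepAt l a) := by
  have h1 : ∀ l, ∑ a ∈ (M l)ᶜ, F (G.stepAt l a) = ∑ a, F (G.stepAt l a) := by
    intro l
    refine Finset.sum_subset (Finset.subset_univ _) fun a _ ha => hF _ ?_
    rw [redden_stepAt_eq_B]
    simpa using ha
  simp only [h1]
  rw [← Fintype.sum_sigma' (f := fun l a => F (G.stepAt l a))]
  refine (Fintype.sum_of_injective _ G.stepAt_injective _ _ ?_ fun _ => rfl).symm
  intro c hc
  refine hF c ?_
  cases h : s c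
  · obtain ⟨l, a, rfl⟩ := G.exists_stepAt h
    exact absurd ⟨⟨l, a⟩, rfl⟩ hc
  · exact G.redden_of_red M h

/-- In an adapted numbering all steps precede the other crossings, so the original red scars never
enter the sign. -/
theorem redBefore_stepAt {ν : D.Numbering} (hν : G.IsAdapted ν) (l : Fin k)
    (a : Fin (G.height l)) :
    redBefore (G.redden M) ν (G.stepAt l a) =
      ∑ m ∈ Finset.Iio l, (M m).card + G.redCount M l a := by
  obtain ⟨h1, h2, h3⟩ := hν
  have hlt : ∀ m (b : Fin (G.height m)), ν (G.stepAt m b) < ν (G.stepAt l a) ↔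
      m < l ∨ (m = l ∧ (b : ℕ) < a) := by
    intro m b
    rcases lt_trichotomy m l with h | rfl | h
    · exact iff_of_true (h2 m l h b a) (Or.inl h)
    · simp only [lt_irrefl, true_and, false_or]
      rcases lt_trichotomy b a with h | rfl | h
      · exact iff_of_true (h1 m b a h) h
      · simp
      · exact iff_of_false (h1 m a b h).not_gt (by have : (a : ℕ) < b := h; omega)
    · refine iff_of_false (h2 l m h a b).not_gt ?_
      rintro (h' | ⟨rfl, -⟩)
      · exact h.not_gt h'
      · exact lt_irrefl _ h
  unfold redBefore
  rw [Finset.card_filter]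
  rw [← Fintype.sum_of_injective (fun p : Σ l, Fin (G.height l) => G.stepAt p.1 p.2)
    G.stepAt_injective (fun p => if p.2 ∈ M p.1 ∧ (p.1 < l ∨ (p.1 = l ∧ (p.2 : ℕ) < a))
      then 1 else 0)]
  · rw [Fintype.sum_sigma]
    have h4 : ∀ m, (∑ b : Fin (G.height m), if b ∈ M m ∧ (m < l ∨ (m = l ∧ (b : ℕ) < a))
        then 1 else 0) =
        (if m < l then (M m).card else 0) + if m = l then G.redCount M l a else 0 := by
      intro m
      rcases lt_trichotomy m l with h | rfl | h
      · simp [h, h.ne]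
      · simp only [lt_irrefl, true_and, false_or, if_true, if_false, zero_add, redCount]
        rw [← Finset.card_filter]
        congr 1
        ext b
        simp
      · simp [h.not_gt, h.ne']
    rw [Finset.sum_congr rfl fun m _ => h4 m, Finset.sum_add_distrib]
    simp only [Finset.sum_ite_eq', Finset.mem_univ, if_true]
    rw [← Finset.sum_filter]
    congr 2
    ext m
    simp
  · intro c hc
    refine if_neg fun h => ?_
    have := h3 l a c fun m b hmb => hc ⟨⟨m, b⟩, hmb⟩
    exact h.2.not_gt this
  · rintro ⟨m, b⟩
    simp only [redden_stepAt_eq_B, hlt]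

/-- Common form of the differential for all-plus and once-marked states; `g` stands for the
contribution of one half of the split circle. -/
theorem sum_crossing_smul {ν : D.Numbering} (hν : G.IsAdapted ν) (e : D.EnhancedState)
    (he : e.state = G.redden M) (g : (∀ l, Finset (Fin (G.height l))) → D.Dart ⊕ D.Loop → D.Chain)
    (hg : ∀ M p q, circleOf (G.redden M) p = circleOf (G.redden M) q → g M p = g M q)
    (hgM : ∀ l a, a ∉ M l → (open Classical in
        ∑ u, if e.AdjacentAt u (G.stepAt l a) then Finsupp.single u (1 : ℤ) else 0) =
      g (G.addStep M l a) (Sum.inl (G.stepAt l a, 0)) +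
        g (G.addStep M l a) (Sum.inl (G.stepAt l a, 2))) :
    D.diff ν (Finsupp.single e 1) = ∑ l, ∑ a ∈ (M l)ᶜ,
        (-1 : ℤ) ^ (∑ m ∈ Finset.Iio l, (M m).card + G.redCount M l a) •
          (g (G.addStep M l a) (Sum.inl (G.dart l a 0)) +
            g (G.addStep M l a) (Sum.inl (G.dart l a 2))) := by
  rw [diff_single_eq_sum, G.sum_crossing M]
  · refine Finset.sum_congr rfl fun l _ => Finset.sum_congr rfl fun a ha => ?_
    rw [Finset.mem_compl] at ha
    rw [he, G.redBefore_stepAt M hν, hgM l a ha]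
    congr 1
    have hmem : a ∈ G.addStep M l a l := by simp [addStep_self]
    rcases G.circleOf_crossing_red ((G.redden_stepAt_eq_B _).2 hmem) with ⟨h0, h2⟩ | ⟨h0, h2⟩
    · rw [hg _ _ _ h0, hg _ _ _ h2]
    · rw [hg _ _ _ h0, hg _ _ _ h2, add_comm]
  · intro c hc
    rw [Finset.sum_eq_zero, smul_zero]
    intro u _
    refine if_neg fun h => ?_
    have := h.1
    rw [he, hc] at this
    cases this

theorem diff_plus {ν : D.Numbering} (hν : G.IsAdapted ν) (hM : ∀ l, (M l).Nonempty) :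
    D.diff ν (Finsupp.single (plus (G.redden M)) 1) = ∑ l, ∑ a ∈ (M l)ᶜ,
        (-1 : ℤ) ^ (∑ m ∈ Finset.Iio l, (M m).card + G.redCount M l a) •
          (Finsupp.single (mark (G.redden (G.addStep M l a)) (Sum.inl (G.dart l a 0))) 1 +
            Finsupp.single (mark (G.redden (G.addStep M l a)) (Sum.inl (G.dart l a 2))) 1) := by
  refine G.sum_crossing_smul M hν _ rfl (fun M p => Finsupp.single (mark (G.redden M) p) 1)
    (fun M p q h => by simp only [mark_congr h]) fun l a ha => ?_
  rw [redden_addStep]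
  exact sum_adjacentAt_plus ((G.redden_stepAt_eq_A M).2 ha) (G.isBichord_addStep ha (hM l))

theorem diff_mark {ν : D.Numbering} (hν : G.IsAdapted ν) (hM : ∀ l, (M l).Nonempty)
    (r : D.Dart ⊕ D.Loop) :
    D.diff ν (Finsupp.single (mark (G.redden M) r) 1) = ∑ l, ∑ a ∈ (M l)ᶜ,
        (-1 : ℤ) ^ (∑ m ∈ Finset.Iio l, (M m).card + G.redCount M l a) •
          (chainTwo (G.redden (G.addStep M l a)) r (Sum.inl (G.dart l a 0)) +
            chainTwo (G.redden (G.addStep M l a)) r (Sum.inl (G.dart l a 2))) := by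
  refine G.sum_crossing_smul M hν _ rfl (fun M p => chainTwo (G.redden M) r p)
    (fun M p q h => chainTwo_congr h) fun l a ha => ?_
  rw [redden_addStep]
  exact sum_adjacentAt_mark ((G.redden_stepAt_eq_A M).2 ha) (G.isBichord_addStep ha (hM l)) r

/-- The sum of all the enhanced states with `μ l` red steps in the `l`-th ladder and all signs
`+`. -/
noncomputable def plusChain (μ : Fin k → ℕ) : D.Chain :=
  ∑ M ∈ G.choices μ, Finsupp.single (plus (G.redden M)) 1

theorem sumChain_eq (μ : Fin k → ℕ) (l : Fin k) :
    G.sumChain μ l = ∑ M ∈ G.choices μ,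
      Finsupp.single (mark (G.redden M) (Sum.inl (G.ladder l).topEnd)) 1 := rfl

theorem diff_plusChain {ν : D.Numbering} (hν : G.IsAdapted ν) (hμ : ∀ l, 1 ≤ μ l)
    (hper : ∀ l, μ l < G.height l → G.peripheryNumber l = 1) :
    D.diff ν (G.plusChain μ) = (2 : ℤ) • G.V μ := by
  rw [plusChain, map_sum, Finset.sum_congr rfl fun M hM =>
    G.diff_plus M hν (nonempty_of_mem_choices hM hμ),
    G.sum_choices_addStep hμ hper (fun M p => Finsupp.single (mark (G.redden M) p) (1 : ℤ))
      (fun M p q h => by simp only [mark_congr h]), V, Finset.smul_sum]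
  rfl

theorem diff_sumChain {ν : D.Numbering} (hν : G.IsAdapted ν) (hμ : ∀ l, 1 ≤ μ l)
    (hper : ∀ l, μ l < G.height l → G.peripheryNumber l = 1) (l : Fin k) :
    D.diff ν (G.sumChain μ l) =
      ∑ m with Even (μ m) ∧ μ m < G.height m, (2 : ℤ) • (-1 : ℤ) ^ (∑ n ∈ Finset.Iio m, μ n) •
        ∑ N ∈ G.choices (bump μ m),
          chainTwo (G.redden N) (Sum.inl (G.ladder l).topEnd) (Sum.inl (G.ladder m).topEnd) := by
  rw [sumChain_eq, map_sum, Finset.sum_congr rfl fun M hM =>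
    G.diff_mark M hν (nonempty_of_mem_choices hM hμ) _,
    G.sum_choices_addStep hμ hper
      (fun M p => chainTwo (G.redden M) (Sum.inl (G.ladder l).topEnd) p)
      (fun M p q h => chainTwo_congr h)]

theorem diff_V {ν : D.Numbering} (hν : G.IsAdapted ν) (hμ : ∀ l, 1 ≤ μ l)
    (hper : ∀ l, μ l < G.height l → G.peripheryNumber l = 1) :
    D.diff ν (G.V μ) = 0 := by
  set good : Finset (Fin k) := Finset.univ.filter fun l => Even (μ l) ∧ μ l < G.height l with hgood
  let X : Fin k → Fin k → D.Chain := fun l m => ∑ N ∈ G.choices (bump (bump μ l) m),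
    chainTwo (G.redden N) (Sum.inl (G.ladder l).topEnd) (Sum.inl (G.ladder m).topEnd)
  have hXc : ∀ l m, X l m = X m l := by
    intro l m
    simp only [X, bump_comm μ l m, chainTwo_comm _ (Sum.inl (G.ladder l).topEnd)]
  have hXs : ∀ l, X l l = 0 := by
    intro l
    simp only [X, chainTwo_self, Finset.sum_const_zero]
  let ε : Fin k → ℤ := fun l => (-1) ^ ∑ m ∈ Finset.Iio l, μ m
  let T : Fin k → Fin k → D.Chain := fun l m =>
    -- The sign for `l < m` comes from the extra red step of the `l`-th ladder, which precedes the
    -- `m`-th one; it is what makes the symmetric `X` antisymmetric.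
    (ε l * (2 * (ε m * if l < m then -1 else 1))) • X l m
  have hT : ∀ l m, T l m = - T m l := by
    intro l m
    simp only [T]
    rw [hXc m l]
    rcases lt_trichotomy l m with h | rfl | h
    · rw [if_pos h, if_neg h.not_gt, ← neg_smul]
      congr 1
      ring
    · simp [hXs]
    · rw [if_neg h.not_gt, if_pos h, ← neg_smul]
      congr 1
      ring
  have hd : ∀ l ∈ good, ε l • D.diff ν (G.sumChain (bump μ l) l) = ∑ m ∈ good, T l m := by
    intro l hl
    rw [G.diff_sumChain hν (μ := bump μ l)]
    · rw [Finset.smul_sum, Finset.sum_filter, hgood, Finset.sum_filter]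
      refine Finset.sum_congr rfl fun m _ => ?_
      -- On the diagonal the parity conditions of the two sides differ, but the chain vanishes: its
      -- two marked circles coincide.
      by_cases hml : m = l
      · subst hml
        have : ∑ N ∈ G.choices (bump (bump μ m) m), chainTwo (G.redden N)
          (Sum.inl (G.ladder m).topEnd) (Sum.inl (G.ladder m).topEnd) = 0 := hXs m
        rw [this]
        simp [T, hXs]
      · rw [bump_apply, if_neg hml, add_zero]
        refine if_congr Iff.rfl ?_ rfl
        rw [sum_Iio_bump]
        simp only [T, X, ε, smul_smul, pow_add]
        congr 1
        split_ifs <;> ring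
    · intro m
      rw [bump_apply]
      have := hμ m
      omega
    · intro m hm
      rw [bump_apply] at hm
      exact hper m (by omega)
  have hV : D.diff ν (G.V μ) = ∑ l ∈ good, ∑ m ∈ good, T l m := by
    rw [V, map_sum]
    refine Finset.sum_congr rfl fun l hl => ?_
    rw [map_smul]
    exact hd l hl
  have hneg : D.diff ν (G.V μ) = - D.diff ν (G.V μ) := by
    conv_rhs => rw [hV, Finset.sum_comm]
    rw [hV]
    simp only [← Finset.sum_neg_distrib]
    exact Finset.sum_congr rfl fun l _ => Finset.sum_congr rfl fun m _ => hT l m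
  -- Integer coefficients equal to their own negatives are zero.
  ext e
  have := DFunLike.congr_fun hneg e
  simp only [Finsupp.coe_neg, Pi.neg_apply, Finsupp.coe_zero, Pi.zero_apply] at this ⊢
  omega

end LadderGrouping

end LinkDiagram

namespace LinkDiagram

variable {D : LinkDiagram}

/-! ### Elements of order two -/

theorem addOrderOf_eq_two {ν : D.Numbering} {i j : ℤ} {x : D.Chain} (hx : x ∈ D.cycles ν i j)
    (h2 : (2 : ℤ) • x ∈ D.boundaries ν i j) (hn : x ∉ D.boundaries ν i j) :
    addOrderOf (Submodule.Quotient.mk ⟨x, hx⟩ : D.Kh ν i j) = 2 := by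
  refine addOrderOf_eq_prime ?_ ?_
  · rw [← Submodule.Quotient.mk_smul, Submodule.Quotient.mk_eq_zero]
    change (2 : ℕ) • x ∈ D.boundaries ν i j
    rwa [two_smul, ← two_smul ℤ x]
  · rw [Ne, Submodule.Quotient.mk_eq_zero]
    exact hn

theorem single_mem_chains {e : D.EnhancedState} {i j : ℤ} (hi : e.degI = i) (hj : e.degJ = j) :
    Finsupp.single e (1 : ℤ) ∈ D.chains i j :=
  Finsupp.single_mem_supported ℤ _ ⟨hi, hj⟩

/-- The sum of the coefficients of the enhanced states that belong to a given Kauffman state. -/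
noncomputable def stateSum (t : D.State) : D.Chain →ₗ[ℤ] ℤ :=
  Finsupp.linearCombination ℤ fun e => if e.state = t then 1 else 0

theorem stateSum_single (t : D.State) (e : D.EnhancedState) :
    stateSum t (Finsupp.single e 1) = if e.state = t then 1 else 0 := by
  simp [stateSum]

/-- If all the red scars of a state are bichords, boundaries in the second highest quantum degree
of this state have an even number of terms in it. -/
theorem even_stateSum_of_mem_boundaries {ν : D.Numbering} {t : D.State}
    (ht : ∀ x, t x = Label.B → IsBichord t x) {i j : ℤ} (hi : numB t = i)
    (hj : i + Fintype.card (Circle t) - 2 = j) {y : D.Chain} (hy : y ∈ D.boundaries ν i j) :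
    Even (stateSum t y) := by
  obtain ⟨x, hx, rfl⟩ := hy
  have key : ∀ e : D.EnhancedState, e.degI = i - 1 → e.degJ = j →
      Even (stateSum t (D.diff ν (Finsupp.single e 1))) := by
    classical
    intro e hei hej
    rw [diff_single_eq_sum, map_sum]
    refine Finset.even_sum _ fun x _ => ?_
    rw [map_smul]
    refine Even.mul_left ?_ _
    by_cases h : e.state x = Label.A ∧ Function.update e.state x Label.B = t
    · obtain ⟨s, f⟩ := e
      obtain ⟨hs, rfl⟩ := h
      have hb := ht x (by simp)
      have hc := card_circle_update hs hb
      have hn := numB_update hs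
      rw [degJ_eq] at hej
      unfold EnhancedState.degI at hei
      simp only at hei hs hb hc hn hi hj
      -- The source has one red scar and one circle fewer than `t`, so in this quantum degree it has
      -- no room for a `-`.
      have h0 : (negs f).card = 0 := by
        push_cast [hc, hn] at *
        omega
      have hf : f = fun _ => 1 :=
        eq_of_negs_eq ((Finset.card_eq_zero.1 h0).trans (negs_one s).symm)
      have := sum_adjacentAt_plus hs hb
      rw [hf]
      unfold plus at this
      rw [this, map_add, stateSum_single, stateSum_single]
      exact ⟨1, by simp [mark]⟩
    · rw [map_sum, Finset.sum_eq_zero]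
      · exact Even.zero
      · intro u _
        split_ifs with hu
        · rw [stateSum_single, if_neg fun h' => h ⟨hu.1, by rw [← adjacentAt_state hu, h']⟩]
        · exact map_zero _
  have hx' : ∀ e ∈ x.support, e.degI = i - 1 ∧ e.degJ = j := fun e he =>
    (Finsupp.mem_supported ℤ x).1 hx he
  rw [← Finsupp.sum_single x, Finsupp.sum, map_sum, map_sum]
  refine Finset.even_sum _ fun e he => ?_
  rw [← mul_one (x e), ← smul_eq_mul, ← Finsupp.smul_single, map_smul, map_smul, smul_eq_mul]
  exact Even.mul_left (key e (hx' e he).1 (hx' e he).2) _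

/-! ### Changing the numbering of the crossings -/

section Renumber

variable (ν ν' : D.Numbering)

/-- The number of pairs of red scars which two numberings order differently. -/
def inversions (s : D.State) : ℕ :=
  ∑ y, ∑ z, (if s y = Label.B then 1 else 0) * (if s z = Label.B then 1 else 0) *
    if ν y < ν z ∧ ν' z < ν' y then 1 else 0

/-- Making `x` red adds as inversions the red scars that the two numberings put on different sides
of `x`. Their number has the parity of the difference of the two `redBefore` counts. -/
theorem inversions_update {s : D.State} {x : D.Crossing} (hs : s x = Label.A) :
    (-1 : ℤ) ^ (inversions ν ν' (Function.update s x Label.B) + redBefore s ν x) =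
      (-1) ^ (inversions ν ν' s + redBefore s ν' x) := by
  let β : D.Crossing → ℕ := fun y => if s y = Label.B then 1 else 0
  let w : D.Crossing → D.Crossing → ℕ := fun y z => if ν y < ν z ∧ ν' z < ν' y then 1 else 0
  have hβ : ∀ y, (if Function.update s x Label.B y = Label.B then 1 else 0) =
      β y + if y = x then 1 else 0 := by
    intro y
    by_cases hy : y = x
    · subst hy; simp [β, hs]
    · simp [β, hy]
  have hwx : w x x = 0 := by simp [w]
  have h1 : inversions ν ν' (Function.update s x Label.B) =
      inversions ν ν' s + ∑ z, β z * w x z + ∑ y, β y * w y x := by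
    have : ∀ y z, (β y + if y = x then 1 else 0) * (β z + if z = x then 1 else 0) * w y z =
        β y * β z * w y z + (if y = x then β z * w y z else 0) +
          (if z = x then β y * w y z else 0) := by
      intro y z
      by_cases hy : y = x <;> by_cases hz : z = x
      · subst hy; subst hz; simp [hwx]
      · simp [hy, hz]; ring
      · simp [hy, hz]; ring
      · simp [hy, hz]
    unfold inversions
    simp only [hβ]
    change ∑ y, ∑ z, (β y + if y = x then 1 else 0) * (β z + if z = x then 1 else 0) * w y z =
      ∑ y, ∑ z, β y * β z * w y z + _ + _
    simp only [this, Finset.sum_add_distrib]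
    congr 1
    · congr 1
      rw [Finset.sum_comm]
      simp
    · simp
  have h2 : redBefore s ν x + ∑ z, β z * w x z = redBefore s ν' x + ∑ y, β y * w y x := by
    unfold redBefore
    rw [Finset.card_filter, Finset.card_filter, ← Finset.sum_add_distrib,
      ← Finset.sum_add_distrib]
    refine Finset.sum_congr rfl fun y _ => ?_
    by_cases hy : s y = Label.B
    · have hyx : y ≠ x := by rintro rfl; rw [hs] at hy; cases hy
      have n1 : ν y ≠ ν x := fun h => hyx (ν.injective h)
      have n2 : ν' y ≠ ν' x := fun h => hyx (ν'.injective h)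
      simp only [β, w, hy, true_and, if_true, one_mul]
      rcases lt_or_gt_of_ne n1 with a | a <;> rcases lt_or_gt_of_ne n2 with b | b <;>
        simp [a, b, a.not_gt, b.not_gt]
    · simp [β, hy]
  have h3 : inversions ν ν' (Function.update s x Label.B) + redBefore s ν x =
      inversions ν ν' s + redBefore s ν' x + 2 * ∑ y, β y * w y x := by
    rw [h1]; omega
  rw [h3, pow_add, pow_mul]
  simp

/-- The isomorphism between the complexes for two numberings. -/
noncomputable def renumber : D.Chain →ₗ[ℤ] D.Chain :=
  Finsupp.linearCombination ℤ fun e => Finsupp.single e ((-1) ^ inversions ν ν' e.state)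

theorem renumber_single (e : D.EnhancedState) :
    renumber ν ν' (Finsupp.single e 1) =
      (-1 : ℤ) ^ inversions ν ν' e.state • Finsupp.single e 1 := by
  simp [renumber]

theorem renumber_renumber (x : D.Chain) : renumber ν ν' (renumber ν ν' x) = x := by
  have : renumber ν ν' ∘ₗ renumber ν ν' = LinearMap.id := by
    refine Finsupp.lhom_ext' fun e => LinearMap.ext_ring ?_
    simp only [LinearMap.comp_apply, Finsupp.lsingle_apply, LinearMap.id_apply, renumber_single,
      map_smul, smul_smul, ← mul_pow]
    simp
  exact LinearMap.congr_fun this x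

theorem diff_renumber (x : D.Chain) :
    D.diff ν' (renumber ν ν' x) = renumber ν ν' (D.diff ν x) := by
  classical
  have : D.diff ν' ∘ₗ renumber ν ν' = renumber ν ν' ∘ₗ D.diff ν := by
    refine Finsupp.lhom_ext' fun e => LinearMap.ext_ring ?_
    simp only [LinearMap.comp_apply, Finsupp.lsingle_apply, renumber_single, map_smul,
      diff_single_eq_sum, Finset.smul_sum, map_sum]
    refine Finset.sum_congr rfl fun x _ => Finset.sum_congr rfl fun u _ => ?_
    split_ifs with h
    · rw [renumber_single, smul_smul, smul_smul, adjacentAt_state h, ← pow_add, ← pow_add,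
        ← inversions_update ν ν' h.1, add_comm]
    · simp
  exact LinearMap.congr_fun this x

theorem renumber_mem_chains {i j : ℤ} {x : D.Chain} (hx : x ∈ D.chains i j) :
    renumber ν ν' x ∈ D.chains i j := by
  rw [renumber, Finsupp.linearCombination_apply]
  refine Submodule.sum_mem _ fun e he => Submodule.smul_mem _ _ ?_
  exact Finsupp.single_mem_supported ℤ _ ((Finsupp.mem_supported ℤ x).1 hx he)

variable {ν ν'}

theorem renumber_mem_cycles {i j : ℤ} {x : D.Chain} (hx : x ∈ D.cycles ν i j) :
    renumber ν ν' x ∈ D.cycles ν' i j := by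
  refine ⟨renumber_mem_chains ν ν' hx.1, ?_⟩
  have h : D.diff ν x = 0 := hx.2
  exact LinearMap.mem_ker.2 (by rw [diff_renumber, h, map_zero])

theorem renumber_mem_boundaries_iff {i j : ℤ} {x : D.Chain} :
    renumber ν ν' x ∈ D.boundaries ν' i j ↔ x ∈ D.boundaries ν i j := by
  constructor
  · rintro ⟨y, hy, h⟩
    refine ⟨renumber ν ν' y, renumber_mem_chains ν ν' hy, ?_⟩
    have h1 := diff_renumber ν ν' (renumber ν ν' y)
    rw [renumber_renumber, h] at h1
    rw [← renumber_renumber ν ν' x, h1, renumber_renumber]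
  · rintro ⟨y, hy, rfl⟩
    exact ⟨renumber ν ν' y, renumber_mem_chains ν ν' hy, diff_renumber ν ν' y⟩

end Renumber

/-! ### Adapted numberings, degrees, and the order of the class of V -/

namespace LadderGrouping

variable {s : D.State} {k : ℕ} (G : D.LadderGrouping s k)

theorem exists_isAdapted : ∃ ν : D.Numbering, G.IsAdapted ν := by
  -- Lexicographic order by ladder and position; the first coordinate `k` puts the remaining
  -- crossings after all ladders.
  let key : D.Crossing → ℕ ×ₗ ℕ :=
    Function.extend (fun p : Σ l, Fin (G.height l) => G.stepAt p.1 p.2)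
      (fun p => toLex ((p.1 : ℕ), (p.2 : ℕ))) fun c => toLex (k, (Fintype.equivFin _ c : ℕ))
  have hstep : ∀ l (a : Fin (G.height l)), key (G.stepAt l a) = toLex ((l : ℕ), (a : ℕ)) :=
    fun l a => G.stepAt_injective.extend_apply _ _ ⟨l, a⟩
  have hother : ∀ c, (∀ l a, G.stepAt l a ≠ c) →
      key c = toLex (k, (Fintype.equivFin _ c : ℕ)) := fun c hc =>
    Function.extend_apply' _ _ _ (by rintro ⟨p, hp⟩; exact hc _ _ hp)
  have hcases : ∀ c, (∃ l a, G.stepAt l a = c) ∨ ∀ l a, G.stepAt l a ≠ c := by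
    intro c
    by_cases h : ∃ l a, G.stepAt l a = c
    · exact Or.inl h
    · push Not at h
      exact Or.inr h
  have hinj : Function.Injective key := by
    intro c c' h
    rcases hcases c with ⟨l, a, rfl⟩ | hc <;> rcases hcases c' with ⟨l', a', rfl⟩ | hc'
    · rw [hstep, hstep, toLex_inj, Prod.mk.injEq] at h
      obtain ⟨h1, h2⟩ := h
      obtain rfl := Fin.ext h1
      obtain rfl := Fin.ext h2
      rfl
    · rw [hstep, hother _ hc', toLex_inj, Prod.mk.injEq] at h
      have := l.2
      omega
    · rw [hstep, hother _ hc, toLex_inj, Prod.mk.injEq] at h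
      have := l'.2
      omega
    · rw [hother _ hc, hother _ hc', toLex_inj, Prod.mk.injEq] at h
      exact (Fintype.equivFin _).injective (Fin.ext h.2)
  let : LinearOrder D.Crossing := LinearOrder.lift' key hinj
  let ν : D.Crossing ≃o Fin (Fintype.card D.Crossing) := (monoEquivOfFin D.Crossing rfl).symm
  have hν : ∀ c c', key c < key c' → ν c < ν c' := fun c c' h => ν.strictMono h
  refine ⟨ν.toEquiv, ?_, ?_, ?_⟩
  · intro l a a' h
    refine hν _ _ ?_
    erw [hstep, hstep]
    exact Prod.Lex.toLex_lt_toLex.2 (Or.inr ⟨rfl, h⟩)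
  · intro l l' h a a'
    refine hν _ _ ?_
    erw [hstep, hstep]
    exact Prod.Lex.toLex_lt_toLex.2 (Or.inl h)
  · intro l a c hc
    refine hν _ _ ?_
    erw [hstep, hother c hc]
    exact Prod.Lex.toLex_lt_toLex.2 (Or.inl l.2)

variable {G} {M : ∀ l, Finset (Fin (G.height l))} {μ : Fin k → ℕ}

variable (M) in
theorem numB_redden : numB (G.redden M) = numB s + ∑ l, (M l).card := by
  unfold numB
  rw [Finset.card_filter, Finset.card_filter]
  have h1 : ∀ c, (if G.redden M c = Label.B then 1 else 0) =
      (if s c = Label.B then 1 else 0) +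
        if s c = Label.A ∧ G.redden M c = Label.B then 1 else 0 := by
    intro c
    cases h : s c
    · simp
    · simp [G.redden_of_red M h]
  simp only [h1, Finset.sum_add_distrib]
  congr 1
  rw [← Fintype.sum_of_injective (fun p : Σ l, Fin (G.height l) => G.stepAt p.1 p.2)
    G.stepAt_injective (fun p => if p.2 ∈ M p.1 then 1 else 0), Fintype.sum_sigma]
  · refine Finset.sum_congr rfl fun l _ => ?_
    rw [← Finset.card_filter]
    congr 1
    ext a
    simp
  · intro c hc
    refine if_neg fun h => hc ?_
    obtain ⟨l, a, rfl⟩ := G.exists_stepAt h.1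
    exact ⟨⟨l, a⟩, rfl⟩
  · rintro ⟨l, a⟩
    simp only [G.stepAt_blue, redden_stepAt_eq_B, true_and]

/-- Both this state and the broken one are compared with the state in which all steps are red. -/
theorem card_circle_of_mem_choices (b : ∀ l, Fin (G.height l)) (hM : M ∈ G.choices μ)
    (hμ : ∀ l, 1 ≤ μ l) :
    Fintype.card (Circle (G.redden M)) + k = Fintype.card (Circle (G.broken b)) + ∑ l, μ l := by
  have h1 := G.card_circle_redden (nonempty_of_mem_choices hM hμ)
  have h2 := G.card_circle_redden (M := fun l => {b l}) fun l => Finset.singleton_nonempty _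
  simp only [Finset.card_singleton, Finset.sum_const, Finset.card_univ, Fintype.card_fin,
    smul_eq_mul, mul_one] at h2
  simp only [mem_choices.1 hM] at h1
  unfold broken
  omega

theorem sum_bump (μ : Fin k → ℕ) (l : Fin k) : ∑ m, bump μ l m = ∑ m, μ m + 1 := by
  simp only [bump_apply, Finset.sum_add_distrib, Finset.sum_ite_eq', Finset.mem_univ, if_true]

theorem plusChain_mem_chains (b : ∀ l, Fin (G.height l)) (hμ : ∀ l, 1 ≤ μ l) :
    G.plusChain μ ∈ D.chains (numB s + 1 + ∑ l, (μ l : ℤ) - 1)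
      (numB s + Fintype.card (Circle (G.broken b)) + 2 * ∑ l, (μ l : ℤ) - k) := by
  refine Submodule.sum_mem _ fun M hM => single_mem_chains ?_ ?_
  · unfold EnhancedState.degI plus
    rw [numB_redden]
    simp only [mem_choices.1 hM]
    push_cast
    ring
  · have h := card_circle_of_mem_choices b hM hμ
    rw [plus, degJ_eq, numB_redden, negs_one]
    simp only [mem_choices.1 hM]
    zify at h
    push_cast
    rw [Finset.card_empty]
    push_cast
    linarith

theorem degI_of_mem_choices {l : Fin k} (hM : M ∈ G.choices (bump μ l)) :
    (numB (G.redden M) : ℤ) = numB s + 1 + ∑ l, (μ l : ℤ) := by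
  rw [numB_redden]
  simp only [mem_choices.1 hM, sum_bump]
  push_cast
  ring

theorem degJ_of_mem_choices (b : ∀ l, Fin (G.height l)) {l : Fin k}
    (hM : M ∈ G.choices (bump μ l)) (hμ : ∀ l, 1 ≤ μ l) :
    numB s + 1 + ∑ l, (μ l : ℤ) + Fintype.card (Circle (G.redden M)) - 2 =
      numB s + Fintype.card (Circle (G.broken b)) + 2 * ∑ l, (μ l : ℤ) - k := by
  have h := card_circle_of_mem_choices b hM fun m => by
    rw [bump_apply]; have := hμ m; omega
  rw [sum_bump] at h
  zify at h
  linarith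

theorem V_mem_chains (b : ∀ l, Fin (G.height l)) (hμ : ∀ l, 1 ≤ μ l) :
    G.V μ ∈ D.chains (numB s + 1 + ∑ l, (μ l : ℤ))
      (numB s + Fintype.card (Circle (G.broken b)) + 2 * ∑ l, (μ l : ℤ) - k) := by
  refine Submodule.sum_mem _ fun l _ => Submodule.smul_mem _ _ ?_
  rw [sumChain_eq]
  refine Submodule.sum_mem _ fun M hM => ?_
  have hI := degI_of_mem_choices hM
  refine single_mem_chains hI ?_
  rw [mark, degJ_eq, hI, negs_markSign, ← degJ_of_mem_choices b hM hμ, Finset.card_singleton]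
  push_cast
  ring

theorem redden_injective : Function.Injective G.redden := by
  intro M N h
  funext l
  ext a
  rw [← redden_stepAt_eq_B, ← redden_stepAt_eq_B, h]

/-- The numbers of red steps of a state determine which ladder was bumped, so only the `r`-th
summand of V meets it, in a single term. -/
theorem stateSum_V {r : Fin k} (hr : Even (μ r) ∧ μ r < G.height r)
    {N : ∀ l, Finset (Fin (G.height l))} (hN : N ∈ G.choices (bump μ r)) :
    stateSum (G.redden N) (G.V μ) = (-1) ^ ∑ m ∈ Finset.Iio r, μ m := by
  have h1 : ∀ l, stateSum (G.redden N) (G.sumChain (bump μ l) l) = if l = r then 1 else 0 := by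
    intro l
    rw [sumChain_eq, map_sum]
    simp only [stateSum_single, mark, redden_injective.eq_iff, Finset.sum_ite_eq']
    refine if_congr ⟨fun h => ?_, fun h => h ▸ hN⟩ rfl rfl
    have e1 := mem_choices.1 h r
    have e2 := mem_choices.1 hN r
    rw [e2, bump_apply, bump_apply, if_pos rfl] at e1
    by_contra hlr
    rw [if_neg (Ne.symm hlr)] at e1
    omega
  rw [V, map_sum]
  simp only [map_smul, smul_eq_mul]
  rw [Finset.sum_eq_single_of_mem r (by simp [hr])]
  · rw [show Function.update μ r (μ r + 1) = bump μ r from rfl, h1, if_pos rfl, mul_one]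
  · intro l _ hl
    rw [show Function.update μ l (μ l + 1) = bump μ l from rfl, h1, if_neg hl, mul_zero]

theorem choices_nonempty (hμ : ∀ l, μ l ≤ G.height l) : (G.choices μ).Nonempty := by
  refine Fintype.piFinset_nonempty.2 fun l => Finset.powersetCard_nonempty.2 ?_
  rw [Finset.card_univ, Fintype.card_fin]
  exact hμ l

/-- The chain `V` is a cycle, its double is a boundary, but `V` is not a boundary. -/
theorem V_torsion (hheight : ∀ l, 2 ≤ G.height l) (b : ∀ l, Fin (G.height l))
    (hred : ∀ c, s c = Label.B → IsBichord (G.broken b) c) {ν : D.Numbering}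
    (hν : G.IsAdapted ν)
    (h1 : ∀ l, G.peripheryNumber l = 1 → 2 ≤ μ l ∧ μ l ≤ G.height l)
    (h2 : ∀ l, G.peripheryNumber l ≠ 1 → μ l = G.height l)
    (h3 : ∃ r, G.peripheryNumber r = 1 ∧ Even (μ r) ∧ μ r < G.height r) :
    G.V μ ∈ D.cycles ν (numB s + 1 + ∑ l, (μ l : ℤ))
        (numB s + Fintype.card (Circle (G.broken b)) + 2 * ∑ l, (μ l : ℤ) - k) ∧
      (2 : ℤ) • G.V μ ∈ D.boundaries ν (numB s + 1 + ∑ l, (μ l : ℤ))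
        (numB s + Fintype.card (Circle (G.broken b)) + 2 * ∑ l, (μ l : ℤ) - k) ∧
      G.V μ ∉ D.boundaries ν (numB s + 1 + ∑ l, (μ l : ℤ))
        (numB s + Fintype.card (Circle (G.broken b)) + 2 * ∑ l, (μ l : ℤ) - k) := by
  have hμ : ∀ l, 2 ≤ μ l ∧ μ l ≤ G.height l := by
    intro l
    by_cases h : G.peripheryNumber l = 1
    · exact h1 l h
    · rw [h2 l h]; exact ⟨hheight l, le_rfl⟩
  have hμ1 : ∀ l, 1 ≤ μ l := fun l => by have := (hμ l).1; omega
  have hper : ∀ l, μ l < G.height l → G.peripheryNumber l = 1 := by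
    intro l hl
    by_contra h
    exact hl.ne (h2 l h)
  refine ⟨⟨V_mem_chains b hμ1, G.diff_V hν hμ1 hper⟩,
    ⟨G.plusChain μ, plusChain_mem_chains b hμ1, G.diff_plusChain hν hμ1 hper⟩, fun hV => ?_⟩
  obtain ⟨r, -, hr⟩ := h3
  -- A spare blue step in the `r`-th ladder is needed for such a state to exist.
  obtain ⟨N, hN⟩ : (G.choices (bump μ r)).Nonempty := by
    refine choices_nonempty fun l => ?_
    rw [bump_apply]
    split_ifs with h
    · subst h; exact hr.2
    · exact (hμ l).2
  have hN2 : ∀ l, 2 ≤ (N l).card := by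
    intro l
    rw [mem_choices.1 hN, bump_apply]
    have := (hμ l).1
    omega
  have hNne : ∀ l, (N l).Nonempty := fun l => Finset.card_pos.1 (by have := hN2 l; omega)
  have hbi : ∀ x, G.redden N x = Label.B → IsBichord (G.redden N) x := by
    intro x hx
    cases h : s x
    · obtain ⟨l, a, rfl⟩ := G.exists_stepAt h
      exact G.isBichord_stepAt ((G.redden_stepAt_eq_B N).1 hx) (hN2 l)
    · exact G.isBichord_redden hNne (N := fun l => {b l}) (fun l => Finset.singleton_nonempty _) h
        (hred x h)
  have := even_stateSum_of_mem_boundaries hbi (degI_of_mem_choices hN)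
    (degJ_of_mem_choices b hN hμ1) hV
  rw [stateSum_V hr hN] at this
  exact Int.not_even_iff_odd.2 (Odd.pow (by decide)) this

end LadderGrouping

end LinkDiagram

theorem corollary5p3 (D : LinkDiagram) (o : D.Orientation) (s₀ : D.State) (k : ℕ)
    (G : D.LadderGrouping s₀ k) (hheight : ∀ l, 2 ≤ G.height l)
    (hladder : ∃ l, G.peripheryNumber l = 1 ∧ 3 ≤ G.height l)
    (b : ∀ l, Fin (G.height l))
    (hred : ∀ c, s₀ c = Label.B → LinkDiagram.IsBichord (G.broken b) c) :
    (∀ ν : D.Numbering, ∃ (h q : ℤ) (ξ : D.LinkKh o ν h q), addOrderOf ξ = 2) ∧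
    ∀ ν : D.Numbering, G.IsAdapted ν → ∀ μ : Fin k → ℕ,
      (∀ l, G.peripheryNumber l = 1 → 2 ≤ μ l ∧ μ l ≤ G.height l) →
      (∀ l, G.peripheryNumber l ≠ 1 → μ l = G.height l) →
      (∃ r, G.peripheryNumber r = 1 ∧ Even (μ r) ∧ μ r < G.height r) →
      ∃ hV : G.V μ ∈ D.cycles ν
          (LinkDiagram.numB s₀ + 1 + ∑ l, (μ l : ℤ))
          (LinkDiagram.numB s₀ + Fintype.card (LinkDiagram.Circle (G.broken b))
            + 2 * ∑ l, (μ l : ℤ) - k),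
        addOrderOf (Submodule.Quotient.mk ⟨G.V μ, hV⟩ :
          D.Kh ν (LinkDiagram.numB s₀ + 1 + ∑ l, (μ l : ℤ))
            (LinkDiagram.numB s₀ + Fintype.card (LinkDiagram.Circle (G.broken b))
              + 2 * ∑ l, (μ l : ℤ) - k)) = 2 := by
  constructor
  · intro ν
    obtain ⟨r, hr, hr3⟩ := hladder
    obtain ⟨ν₀, hν₀⟩ := G.exists_isAdapted
    have hle : ∀ l, Function.update G.height r 2 l ≤ G.height l := by
      intro l
      by_cases h : l = r
      · subst h; simpa using hheight l
      · simp [h]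
    have hge : ∀ l, 2 ≤ Function.update G.height r 2 l := by
      intro l
      by_cases h : l = r
      · subst h; simp
      · simpa [h] using hheight l
    -- All ladders are fully reddened except the `r`-th, where 2 is even and less than the height,
    -- which is at least 3.
    obtain ⟨hc, h2, hn⟩ := G.V_torsion (μ := Function.update G.height r 2) hheight b hred hν₀
      (fun l _ => ⟨hge l, hle l⟩)
      (fun l hl => Function.update_of_ne (by rintro rfl; exact hl hr) _ _)
      ⟨r, hr, by simp, by rw [Function.update_self]; omega⟩
    generalize (LinkDiagram.numB s₀ : ℤ) + 1 + ∑ l, (Function.update G.height r 2 l : ℤ) = i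
      at hc h2 hn
    generalize (LinkDiagram.numB s₀ : ℤ) + Fintype.card (LinkDiagram.Circle (G.broken b))
      + 2 * ∑ l, (Function.update G.height r 2 l : ℤ) - k = j at hc h2 hn
    obtain ⟨h, rfl⟩ : ∃ h : ℤ, h + o.numNeg = i := ⟨i - o.numNeg, by ring⟩
    obtain ⟨q, rfl⟩ : ∃ q : ℤ, q - o.numPos + 2 * o.numNeg = j :=
      ⟨j + o.numPos - 2 * o.numNeg, by ring⟩
    -- The class found for the adapted numbering is carried over to the given one.
    refine ⟨h, q, _, LinkDiagram.addOrderOf_eq_two (LinkDiagram.renumber_mem_cycles (ν' := ν) hc)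
      ?_ ?_⟩
    · rw [← map_smul]
      exact LinkDiagram.renumber_mem_boundaries_iff.2 h2
    · exact fun hb => hn (LinkDiagram.renumber_mem_boundaries_iff.1 hb)
  · intro ν hν μ h1 h2 h3
    obtain ⟨hc, hb, hn⟩ := G.V_torsion hheight b hred hν h1 h2 h3
    exact ⟨hc, LinkDiagram.addOrderOf_eq_two hc hb hn⟩
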